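/- Let $V=\bigoplus_{n\ge 0}V_n$ be a vertex operator algebra over $\mathbb{C}$ of CFT type (so $V_0=\mathbb{C}\mathbf{1}$), and put $V_+=\bigoplus_{n\ge 1}V_n$. For an admissible $V$-module $M=\bigoplus_{n\ge 0}M(n)$ let $O(M)$ be the span of all $\mathrm{Res}_z\,Y_M(a,z)w\,\frac{(1+z)^{\mathrm{wt}\,a}}{z^2}$ with $a\in V$ homogeneous and $w\in M$. Let $A(V)=V/O(V)$ be Zhu's algebra, with product induced by $a*b=\mathrm{Res}_z\,Y(a,z)b\,\frac{(1+z)^{\mathrm{wt}\,a}}{z}$, and let $A(M)=M/O(M)$ be the $A(V)$-bimodule with actions induced by $a*w=\mathrm{Res}_z\,Y_M(a,z)w\,\frac{(1+z)^{\mathrm{wt}\,a}}{z}$ and $w*a=\mathrm{Res}_z\,Y_M(a,z)w\,\frac{(1+z)^{\mathrm{wt}\,a-1}}{z}$. Let $A(V)_n$ and $A(M)_n$ be the images of $\bigoplus_{i=0}^n V_i$ in $A(V)$ and of $\bigoplus_{i=0}^n M(i)$ in $A(M)$. For admissible $V$-modules $M,N$ and $r\ge 0$ put $$(A(M)\otimes_{A(V)}A(N))_r=\mathrm{span}\{x\otimes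 y : x\in A(M)_k,\ y\in A(N)_l,\ k+l\le r\},$$ $$(A(V)\otimes_{\mathbb{C}}A(V)^{op})_r=\mathrm{span}\{a\otimes b : a\in A(V)_k,\ b\in A(V)_l,\ k+l\le r\},$$ and let $A(V)\otimes_{\mathbb{C}}A(V)^{op}$ act on $A(M)\otimes_{A(V)}A(N)$ by $(a\otimes b).(x\otimes y)=(a*x)\otimes(y*b)$. Say that $M$ is strongly generated by a subset $W\subseteq M$ if $M$ is spanned by the elements $a^1_{-n_1}\cdots a^k_{-n_k}w$ with $k\ge 0$, $a^i\in V_+$ homogeneous, $n_i\ge 1$ and $w\in W$. Assume that $M$ and $N$ are strongly generated by their bottom levels $M(0)=\mathbb{C}u_1+\dots+\mathbb{C}u_m$ and $N(0)=\mathbb{C}v_1+\dots+\mathbb{C}v_n$. Then for all $r\ge 0$ $$(A(M)\otimes_{A(V)}A(N))_r=\sum_{i=1}^m\sum_{j=1}^n (A(V)\otimes_{\mathbb{C}}A(V)^{op})_r.(u_i\otimes v_j),$$ where $u_i$ and $v_j$ also denote their images in $A(M)$ and $A(N)$. -/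

import Mathlib

namespace VOA

section Formal

variable {E : Type*} [AddCommGroup E]

theorem finsum_eq_range {f : ℕ → E} (N : ℕ) (h : ∀ i, N ≤ i → f i = 0) :
    ∑ᶠ i, f i = ∑ i ∈ Finset.range N, f i := by
  refine finsum_eq_sum_of_support_subset f fun i hi => ?_
  by_contra hc
  exact hi (h i (by simpa using hc))

/-- Shift operators on functions of three integer variables. -/
def shift (d : ℤ × ℤ × ℤ) : Module.End ℤ (ℤ × ℤ × ℤ → E) where
  toFun B t := B (t + d)
  map_add' _ _ := rfl
  map_smul' _ _ := rfl

theorem shift_pow (d : ℤ × ℤ × ℤ) (m : ℕ) (B : ℤ × ℤ × ℤ → E) (t : ℤ × ℤ × ℤ) :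
    ((shift d : Module.End ℤ (ℤ × ℤ × ℤ → E)) ^ m) B t = B (t + m • d) := by
  induction m generalizing t with
  | zero => simp
  | succ m ih =>
    rw [pow_succ', Module.End.mul_apply]
    change ((shift d : Module.End ℤ (ℤ × ℤ × ℤ → E)) ^ m) B (t + d) = _
    rw [ih, succ_nsmul']
    congr 1
    abel

theorem shift_comm (d e : ℤ × ℤ × ℤ) : Commute (shift (E := E) d) (shift e) := by
  ext B t
  change B (t + d + e) = B (t + e + d)
  congr 1
  abel

theorem one_add_shift_pow (d : ℤ × ℤ × ℤ) (k : ℕ) (B : ℤ × ℤ × ℤ → E) (t : ℤ × ℤ × ℤ) :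
    ((1 + (shift d : Module.End ℤ (ℤ × ℤ × ℤ → E))) ^ k) B t = ∑ j ∈ Finset.range (k + 1), k.choose j • B (t + j • d) := by
  rw [add_comm, (Commute.one_right (shift d)).add_pow]
  simp only [one_pow, mul_one, LinearMap.sum_apply, Finset.sum_apply, ← Nat.cast_comm,
    ← nsmul_eq_mul, LinearMap.smul_apply, Pi.smul_apply, shift_pow]

theorem shift_expand (B : ℤ × ℤ × ℤ → E)
    (hB : ∀ p q r, B (p + 1, q, r) = B (p, q + 1, r) + B (p, q, r + 1)) (k l : ℕ) (p q r : ℤ) :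
    ∑ i ∈ Finset.range (k + 1), k.choose i • ∑ j ∈ Finset.range (l + 1), l.choose j •
        B (p + i, q + j, r) =
      ∑ s ∈ Finset.range (k + 1), k.choose s • ∑ j ∈ Finset.range (k - s + l + 1),
        (k - s + l).choose j • B (p, q + j, r + s) := by
  set P : Module.End ℤ (ℤ × ℤ × ℤ → E) := shift (1, 0, 0)
  set Q : Module.End ℤ (ℤ × ℤ × ℤ → E) := shift (0, 1, 0)
  set R : Module.End ℤ (ℤ × ℤ × ℤ → E) := shift (0, 0, 1)
  have hPQ : Commute P Q := shift_comm _ _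
  have hPR : Commute P R := shift_comm _ _
  have hQR : Commute Q R := shift_comm _ _
  have h1 : ∀ k : ℕ, ((1 + P) ^ k) B = ((R + (1 + Q)) ^ k) B := by
    intro k
    induction k with
    | zero => simp
    | succ k ih =>
      have hc : Commute ((1 + P) ^ k) (R + (1 + Q)) :=
        Commute.pow_left ((Commute.add_left (Commute.one_left _)
          (hPR.add_right ((Commute.one_right _).add_right hPQ)))) k
      have h0 : (1 + P) B = (R + (1 + Q)) B := by
        funext t
        obtain ⟨p, q, r⟩ := t
        have := hB p q r
        simp only [LinearMap.add_apply, Module.End.one_apply, Pi.add_apply]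
        change B (p, q, r) + B ((p, q, r) + (1, 0, 0)) =
          B ((p, q, r) + (0, 0, 1)) + (B (p, q, r) + B ((p, q, r) + (0, 1, 0)))
        simp only [Prod.mk_add_mk, add_zero, this]
        abel
      rw [pow_succ, Module.End.mul_apply, h0, ← Module.End.mul_apply, hc.eq,
        Module.End.mul_apply, ih, ← Module.End.mul_apply, ← pow_succ']
  have h2 : (((1 + Q) ^ l) (((1 + P) ^ k) B)) (p, q, r) =
      (((1 + Q) ^ l) (((R + (1 + Q)) ^ k) B)) (p, q, r) := by rw [h1]
  have hR1Q : Commute R (1 + Q) := (Commute.one_right _).add_right hQR.symm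
  have hc2 : Commute ((1 + P) ^ k) ((1 + Q) ^ l) :=
    Commute.pow_pow ((Commute.add_left (Commute.one_left _)
          (((Commute.one_right _).add_right hPQ)))) _ _
  rw [← Module.End.mul_apply, ← hc2.eq, Module.End.mul_apply, hR1Q.add_pow,
    ← Module.End.mul_apply ((1 + Q) ^ l), Finset.mul_sum] at h2
  have h3 : ∀ m, (1 + Q) ^ l * (R ^ m * (1 + Q) ^ (k - m) *
      ((k.choose m : ℕ) : Module.End ℤ (ℤ × ℤ × ℤ → E))) =
      k.choose m • (R ^ m * (1 + Q) ^ (k - m + l)) := by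
    intro m
    rw [← Nat.cast_comm, ← nsmul_eq_mul, mul_smul_comm, ← mul_assoc,
      ← (hR1Q.pow_pow m l).eq, mul_assoc, ← pow_add, add_comm l]
  simp only [h3, LinearMap.sum_apply, Finset.sum_apply, LinearMap.smul_apply, Pi.smul_apply,
    Module.End.mul_apply, P, Q, R, shift_pow, one_add_shift_pow] at h2
  simpa [Prod.mk_add_mk] using h2

/-- If `x`, `y`, `z` satisfy the family of Borcherds identities, then they satisfy the family
obtained from it by inserting the kernel `(1 + z)^k (1 + w)^l`. -/
theorem formal_borcherds (x y z : ℤ → ℤ → E) (T : ℕ)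
    (hx : ∀ t m : ℤ, T ≤ t → x t m = 0) (hy : ∀ m n : ℤ, T ≤ n → y m n = 0)
    (hz : ∀ m n : ℤ, T ≤ m → z m n = 0)
    (h : ∀ p q r : ℤ, ∑ᶠ i : ℕ, Ring.choose p i • x (r + i) (p + q - i) =
      ∑ᶠ i : ℕ, ((-1) ^ i * Ring.choose r i) •
        (y (p + r - i) (q + i) - (r.negOnePow : ℤ) • z (p + i) (q + r - i)))
    (k l : ℕ) (p q r : ℤ) :
    ∑ᶠ u : ℕ, Ring.choose p u • ∑ s ∈ Finset.range (k + 1), k.choose s •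
      ∑ j ∈ Finset.range (k - s + l + 1), (k - s + l).choose j • x (r + s + u) (p + q - u + j) =
    ∑ᶠ i : ℕ, ((-1) ^ i * Ring.choose r i) •
      ((∑ i' ∈ Finset.range (k + 1), k.choose i' • ∑ j ∈ Finset.range (l + 1), l.choose j •
          y (p + r - i + i') (q + i + j)) -
        (r.negOnePow : ℤ) • ∑ i' ∈ Finset.range (k + 1), k.choose i' •
          ∑ j ∈ Finset.range (l + 1), l.choose j • z (p + i + i') (q + r - i + j)) := by
  set B : ℤ × ℤ × ℤ → E := fun t =>
    ∑ᶠ i : ℕ, Ring.choose t.1 i • x (t.2.2 + i) (t.1 + t.2.1 - i) with hBdef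
  have hBsum : ∀ p q r : ℤ, ∀ N : ℕ, T - r ≤ N → B (p, q, r) =
      ∑ i ∈ Finset.range N, Ring.choose p i • x (r + i) (p + q - i) := by
    intro p q r N hN
    refine finsum_eq_range N fun i hi => ?_
    rw [hx _ _ (by change (T : ℤ) ≤ r + i; omega), smul_zero]
  have hB : ∀ p q r, B (p + 1, q, r) = B (p, q + 1, r) + B (p, q, r + 1) := by
    intro p q r
    obtain ⟨N, hN⟩ : ∃ N : ℕ, T - r ≤ N := ⟨(T - r).toNat, by omega⟩
    rw [hBsum (p + 1) q r (N + 1) (by push_cast; omega),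
      hBsum p (q + 1) r (N + 1) (by push_cast; omega), hBsum p q (r + 1) N (by omega),
      Finset.sum_range_succ', Finset.sum_range_succ' (n := N)]
    simp only [Ring.choose_succ_succ, add_smul, Finset.sum_add_distrib, Ring.choose_zero_right]
    have e1 : ∀ i : ℕ, p + (q + 1) - ((i + 1 : ℕ) : ℤ) = p + q - i := by intro i; push_cast; ring
    have e3 : ∀ i : ℕ, r + 1 + (i : ℤ) = r + ((i + 1 : ℕ) : ℤ) := by intro i; push_cast; ring
    have e4 : p + 1 + q = p + (q + 1) := by ring
    simp only [e1, e3, e4]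
    abel
  have key := shift_expand B hB k l p q r
  obtain ⟨N, hN⟩ : ∃ N : ℕ, T - r ≤ N ∧ T - q ≤ N ∧ T - p ≤ N :=
    ⟨(T - r).toNat + (T - q).toNat + (T - p).toNat, by omega⟩
  have hBr : ∀ i j : ℕ, B (p + i, q + j, r) =
      ∑ u ∈ Finset.range N, ((-1) ^ u * Ring.choose r u) •
        (y (p + i + r - u) (q + j + u) -
          (r.negOnePow : ℤ) • z (p + i + u) (q + j + r - u)) := by
    intro i j
    rw [hBdef]
    dsimp only
    rw [h]
    refine finsum_eq_range N fun u hu => ?_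
    rw [hy _ _ (by omega), hz _ _ (by omega)]
    simp
  have hBl : ∀ j s : ℕ, B (p, q + j, r + s) = ∑ u ∈ Finset.range N,
      Ring.choose p u • x (r + s + u) (p + (q + j) - u) := by
    intro j s
    exact hBsum _ _ _ _ (by omega)
  simp only [hBr, hBl] at key
  rw [finsum_eq_range N, finsum_eq_range N]
  · symm
    convert key using 1
    · simp only [Finset.smul_sum, smul_sub, Finset.sum_sub_distrib]
      congr 1
      · rw [Finset.sum_comm]
        refine Finset.sum_congr rfl fun i _ => ?_
        rw [Finset.sum_comm]
        refine Finset.sum_congr rfl fun j _ => Finset.sum_congr rfl fun u _ => ?_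
        rw [smul_comm _ (k.choose i), smul_comm _ (l.choose j)]
        congr 4 <;> ring
      · rw [Finset.sum_comm]
        refine Finset.sum_congr rfl fun i _ => ?_
        rw [Finset.sum_comm]
        refine Finset.sum_congr rfl fun j _ => Finset.sum_congr rfl fun u _ => ?_
        rw [smul_comm _ (k.choose i), smul_comm _ (k.choose i), smul_comm _ (l.choose j),
          smul_comm _ (l.choose j)]
        congr 5 <;> ring
    · simp only [Finset.smul_sum]
      rw [Finset.sum_comm]
      refine Finset.sum_congr rfl fun i _ => ?_
      rw [Finset.sum_comm]
      refine Finset.sum_congr rfl fun j _ => Finset.sum_congr rfl fun u _ => ?_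
      rw [smul_comm _ (k.choose i), smul_comm _ ((k - i + l).choose j)]
      congr 4
      ring
  · intro u hu
    rw [Finset.sum_eq_zero, Finset.sum_eq_zero]
    · simp
    · intro i _
      rw [Finset.sum_eq_zero, smul_zero]
      intro j _
      rw [hz _ _ (by omega), smul_zero]
    · intro i _
      rw [Finset.sum_eq_zero, smul_zero]
      intro j _
      rw [hy _ _ (by omega), smul_zero]
  · intro u hu
    rw [Finset.sum_eq_zero, smul_zero]
    intro i _
    rw [Finset.sum_eq_zero, smul_zero]
    intro j _
    rw [hx _ _ (by omega), smul_zero]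

end Formal
/-! ### Vertex operator algebras of CFT type and admissible modules -/

/-- The Borcherds identity, that is, the Jacobi identity for vertex operators written in modes:
for `a, b ∈ V`, `w ∈ W` and `p, q, r ∈ ℤ`,
`∑ᵢ C(p, i) (a_{r+i} b)_{p+q-i} w
  = ∑ᵢ (-1)ⁱ C(r, i) (a_{p+r-i} b_{q+i} w - (-1)^r b_{q+r-i} a_{p+i} w)`.
All the sums are finite, because vertex operators take values in Laurent series. -/
def BorcherdsIdentity {V W : Type*} [AddCommGroup V] [Module ℂ V] [AddCommGroup W] [Module ℂ W]
    (Y : V →ₗ[ℂ] VertexOperator ℂ V) (YW : V →ₗ[ℂ] VertexOperator ℂ W) : Prop :=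
  ∀ (a b : V) (w : W) (p q r : ℤ),
    ∑ᶠ i : ℕ, Ring.choose p i •
        (YW ((Y a).ncoeff (r + i) b)).ncoeff (p + q - i) w =
      ∑ᶠ i : ℕ, ((-1) ^ i * Ring.choose r i) •
        ((YW a).ncoeff (p + r - i) ((YW b).ncoeff (q + i) w) -
          (r.negOnePow : ℤ) • (YW b).ncoeff (q + r - i) ((YW a).ncoeff (p + i) w))

/-- The mode `a_m` of a vector `a` of weight `k` maps degree `n` to degree `k + n - m - 1`, where
the components of negative degree are zero. -/
def HomogeneousModes {V W : Type*} [AddCommGroup V] [Module ℂ V] [AddCommGroup W] [Module ℂ W]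
    (YW : V →ₗ[ℂ] VertexOperator ℂ W) (grV : ℕ → Submodule ℂ V) (grW : ℕ → Submodule ℂ W) : Prop :=
  ∀ (k n : ℕ) (m : ℤ), ∀ a ∈ grV k, ∀ w ∈ grW n,
    (∀ d : ℕ, (d : ℤ) = k + n - m - 1 → (YW a).ncoeff m w ∈ grW d) ∧
      ((k : ℤ) + n - m - 1 < 0 → (YW a).ncoeff m w = 0)

/-- A vertex operator algebra `(V, Y, 𝟏, ω)` over `ℂ` of CFT type: `V = ⨁_{n ≥ 0} Vₙ` with
`V₀ = ℂ 𝟏`. The operators of the Virasoro algebra are `L(n) = ω_{n+1}`. -/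
class CFTTypeVOA (V : Type*) [AddCommGroup V] [Module ℂ V] where
  /-- the vertex operators `Y(a, z)`, with `a_n = (Y a).ncoeff n` -/
  Y : V →ₗ[ℂ] VertexOperator ℂ V
  /-- the vacuum vector `𝟏` -/
  vac : V
  /-- the conformal vector `ω` -/
  conf : V
  /-- the central charge -/
  charge : ℂ
  /-- the homogeneous component `Vₙ` -/
  grade : ℕ → Submodule ℂ V
  isInternal : DirectSum.IsInternal grade
  finiteDimensional : ∀ n, FiniteDimensional ℂ (grade n)
  grade_zero : grade 0 = Submodule.span ℂ {vac}
  conf_mem : conf ∈ grade 2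
  vac_ncoeff : ∀ n : ℤ, (Y vac).ncoeff n = if n = -1 then 1 else 0
  creation : ∀ a : V, (Y a).ncoeff (-1) vac = a
  creation_nonneg : ∀ (a : V) (n : ℤ), 0 ≤ n → (Y a).ncoeff n vac = 0
  borcherds : BorcherdsIdentity Y Y
  virasoro : ∀ m n : ℤ, ⁅(Y conf).ncoeff (m + 1), (Y conf).ncoeff (n + 1)⁆ =
    ((m : ℂ) - n) • (Y conf).ncoeff (m + n + 1) +
      if m + n = 0 then (((m : ℂ) ^ 3 - m) / 12 * charge) • (1 : Module.End ℂ V) else 0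
  L_zero : ∀ n : ℕ, ∀ a ∈ grade n, (Y conf).ncoeff 1 a = (n : ℂ) • a
  L_neg_one : ∀ (a : V) (n : ℤ),
    (Y ((Y conf).ncoeff 0 a)).ncoeff n = (-n : ℂ) • (Y a).ncoeff (n - 1)
  homogeneous : HomogeneousModes Y grade grade

/-- An admissible module `W = ⨁_{n ≥ 0} W(n)` over a vertex operator algebra `V`. -/
class AdmissibleModule (V W : Type*) [AddCommGroup V] [Module ℂ V] [CFTTypeVOA V]
    [AddCommGroup W] [Module ℂ W] where
  /-- the vertex operators `Y_W(a, z)`, with `a_n = (Y a).ncoeff n` -/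
  Y : V →ₗ[ℂ] VertexOperator ℂ W
  /-- the homogeneous component `W(n)` -/
  grade : ℕ → Submodule ℂ W
  isInternal : DirectSum.IsInternal grade
  vac_ncoeff : ∀ n : ℤ, (Y (CFTTypeVOA.vac : V)).ncoeff n = if n = -1 then 1 else 0
  borcherds : BorcherdsIdentity CFTTypeVOA.Y Y
  homogeneous : HomogeneousModes Y CFTTypeVOA.grade grade

/-- A vertex operator algebra is an admissible module over itself. -/
instance adjointModule (V : Type*) [AddCommGroup V] [Module ℂ V] [CFTTypeVOA V] :
    AdmissibleModule V V where
  Y := CFTTypeVOA.Y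
  grade := CFTTypeVOA.grade
  isInternal := CFTTypeVOA.isInternal
  vac_ncoeff := CFTTypeVOA.vac_ncoeff
  borcherds := CFTTypeVOA.borcherds
  homogeneous := CFTTypeVOA.homogeneous

section Residues

variable {V : Type*} [AddCommGroup V] [Module ℂ V] [CFTTypeVOA V]
variable {W : Type*} [AddCommGroup W] [Module ℂ W] [AdmissibleModule V W]

open CFTTypeVOA (vac conf)

/-- The mode `a_n`, acting on a module and depending linearly on `a`. -/
noncomputable def mode (n : ℤ) : V →ₗ[ℂ] Module.End ℂ W :=
  LinearMap.proj n ∘ₗ VertexOperator.ncoeff ∘ₗ AdmissibleModule.Y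

/-- The operator `Res_z Y(a, z) (1 + z)^k z^n = ∑ⱼ C(k, j) a_{n+j}`. -/
noncomputable def res (k : ℕ) (n : ℤ) : V →ₗ[ℂ] Module.End ℂ W :=
  ∑ j ∈ Finset.range (k + 1), k.choose j • mode (n + j)

theorem res_apply (k : ℕ) (n : ℤ) (a : V) (w : W) :
    res k n a w = ∑ j ∈ Finset.range (k + 1), k.choose j • mode (n + j) a w := by
  simp [res, LinearMap.sum_apply]

theorem res_zero (n : ℤ) (a : V) (w : W) : res 0 n a w = mode n a w := by
  simp [res_apply]

theorem res_succ (k : ℕ) (n : ℤ) (a : V) (w : W) :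
    res (k + 1) n a w = res k n a w + res k (n + 1) a w := by
  let f : ℤ × ℤ × ℤ → W := fun t => mode t.1 a w
  have h : ∀ (k : ℕ) (n : ℤ), res k n a w =
      ((1 + (shift (1, 0, 0) : Module.End ℤ (ℤ × ℤ × ℤ → W))) ^ k) f (n, 0, 0) := by
    intro k n
    rw [one_add_shift_pow, res_apply]
    simp [f]
  rw [h, pow_succ', Module.End.mul_apply, h, h]
  rfl

theorem mode_truncate (a : V) (w : W) : ∃ T : ℕ, ∀ n : ℤ, T ≤ n → mode n a w = 0 := by
  set x := HahnSeries.order ((HahnModule.of ℂ).symm (AdmissibleModule.Y a w)) with hx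
  refine ⟨(-x).toNat, fun n hn => ?_⟩
  exact VertexOperator.ncoeff_eq_zero_of_lt_order _ _ _ (by omega)

theorem mode_mem {k n d : ℕ} {m : ℤ} {a : V} {w : W} (ha : a ∈ CFTTypeVOA.grade k)
    (hw : w ∈ AdmissibleModule.grade V n) (hd : (d : ℤ) = k + n - m - 1) :
    mode m a w ∈ AdmissibleModule.grade V d :=
  (AdmissibleModule.homogeneous k n m a ha w hw).1 d hd

theorem mode_eq_zero {k n : ℕ} {m : ℤ} {a : V} {w : W} (ha : a ∈ CFTTypeVOA.grade k)
    (hw : w ∈ AdmissibleModule.grade V n) (hd : (k : ℤ) + n - m - 1 < 0) :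
    mode m a w = 0 :=
  (AdmissibleModule.homogeneous k n m a ha w hw).2 hd

theorem mode_vac (n : ℤ) (w : W) : mode n (vac : V) w = if n = -1 then w else 0 := by
  change (AdmissibleModule.Y (vac : V)).ncoeff n w = _
  rw [AdmissibleModule.vac_ncoeff]
  split_ifs <;> rfl

theorem vac_mem : (vac : V) ∈ CFTTypeVOA.grade 0 := by
  rw [CFTTypeVOA.grade_zero]
  exact Submodule.mem_span_singleton_self _

theorem borcherds_res (a b : V) (w : W) (k l : ℕ) (p q r : ℤ) :
    ∑ᶠ u : ℕ, Ring.choose p u • ∑ s ∈ Finset.range (k + 1), k.choose s •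
      res (k - s + l) (p + q - u) (mode (W := V) (r + s + u) a b) w =
    ∑ᶠ i : ℕ, ((-1) ^ i * Ring.choose r i) •
      (res k (p + r - i) a (res l (q + i) b w) -
        (r.negOnePow : ℤ) • res l (q + r - i) b (res k (p + i) a w)) := by
  obtain ⟨T₁, h₁⟩ := mode_truncate (W := V) a b
  obtain ⟨T₂, h₂⟩ := mode_truncate b w
  obtain ⟨T₃, h₃⟩ := mode_truncate a w
  have := formal_borcherds (fun t m => mode m (mode (W := V) t a b) w)
    (fun m n => mode m a (mode n b w)) (fun m n => mode n b (mode m a w)) (T₁ + T₂ + T₃)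
    (fun t m ht => by simp [h₁ t (by push_cast at ht; omega)])
    (fun m n ht => by simp [h₂ n (by push_cast at ht; omega)])
    (fun m n ht => by simp [h₃ m (by push_cast at ht; omega)])
    (fun p q r => AdmissibleModule.borcherds a b w p q r) k l p q r
  simp only [res_apply]
  rw [this]
  refine finsum_congr fun i => ?_
  congr 2
  · simp only [map_sum, map_nsmul]
  · congr 1
    simp only [map_sum, map_nsmul, Finset.smul_sum]
    rw [Finset.sum_comm]
    refine Finset.sum_congr rfl fun i _ => Finset.sum_congr rfl fun j _ => ?_
    rw [smul_comm]

theorem res_comm (a b : V) (w : W) (k l : ℕ) (p q : ℤ) :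
    res k p a (res l q b w) - res l q b (res k p a w) =
    ∑ᶠ u : ℕ, Ring.choose p u • ∑ s ∈ Finset.range (k + 1), k.choose s •
      res (k - s + l) (p + q - u) (mode (W := V) (s + u) a b) w := by
  have h := borcherds_res a b w k l p q 0
  simp only [zero_add, add_zero] at h
  rw [h, finsum_eq_range 1]
  · simp
  · intro i hi
    obtain ⟨i, rfl⟩ := Nat.exists_eq_add_of_le' hi
    rw [Ring.choose_zero_succ]
    simp

theorem res_assoc (a b : V) (w : W) (k l : ℕ) (q r : ℤ) :
    ∑ s ∈ Finset.range (k + 1), k.choose s •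
      res (k - s + l) q (mode (W := V) (r + s) a b) w =
    ∑ᶠ i : ℕ, ((-1) ^ i * Ring.choose r i) •
      (res k (r - i) a (res l (q + i) b w) -
        (r.negOnePow : ℤ) • res l (q + r - i) b (res k i a w)) := by
  have h := borcherds_res a b w k l 0 q r
  simp only [zero_add] at h
  rw [← h, finsum_eq_range 1]
  · simp
  · intro i hi
    obtain ⟨i, rfl⟩ := Nat.exists_eq_add_of_le' hi
    rw [Ring.choose_zero_succ, zero_smul]

theorem mode_L_neg_one (a : V) (n : ℤ) (w : W) :
    mode n (mode (W := V) 0 (conf : V) a) w = (-n : ℂ) • mode (n - 1) a w := by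
  have h0 : mode (W := V) 0 (conf : V) a = mode (W := V) (-2) a vac := by
    have h1 : (CFTTypeVOA.Y ((CFTTypeVOA.Y (conf : V)).ncoeff 0 a)).ncoeff (-1) vac =
        ((-(-1 : ℤ) : ℂ) • (CFTTypeVOA.Y a).ncoeff (-1 - 1)) vac := by
      rw [CFTTypeVOA.L_neg_one]
    rw [CFTTypeVOA.creation] at h1
    change (CFTTypeVOA.Y (conf : V)).ncoeff 0 a = (CFTTypeVOA.Y a).ncoeff (-2) vac
    rw [h1]
    norm_num
  have h := res_assoc a vac w 0 0 n (-2)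
  have hc : ∀ i : ℕ, (-1 : ℤ) ^ i * Ring.choose (-2 : ℤ) i = i + 1 := by
    intro i
    rw [Ring.choose_neg', Ring.multichoose_two, Units.smul_def, smul_eq_mul, ← mul_assoc,
      Int.coe_negOnePow_natCast, ← mul_pow]
    simp
  have h2 : ((-2 : ℤ).negOnePow : ℤ) = 1 := by rw [Int.negOnePow_even _ (by decide)]; rfl
  simp only [hc, h2, res_zero, mode_vac, zero_add, Finset.range_one, Finset.sum_singleton,
    Nat.choose_self, one_smul, Nat.cast_zero, add_zero, Nat.sub_self] at h
  rw [h0, h]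
  rcases lt_trichotomy n 0 with hn | hn | hn
  · rw [finsum_eq_single _ (-1 - n).toNat]
    · rw [if_pos (by omega), if_neg (by omega), sub_zero,
        show (-2 : ℤ) - ((-1 - n).toNat : ℕ) = n - 1 by omega,
        show (((-1 - n).toNat : ℕ) : ℤ) + 1 = -n by omega, ← Int.cast_smul_eq_zsmul ℂ]
      push_cast
      rfl
    · intro i hi
      rw [if_neg (by omega), if_neg (by omega)]
      simp
  · rw [finsum_eq_zero_of_forall_eq_zero]
    · simp [hn]
    · intro i
      rw [if_neg (by omega), if_neg (by omega)]
      simp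
  · rw [finsum_eq_single _ (n - 1).toNat]
    · rw [if_neg (by omega), if_pos (by omega), map_zero, zero_sub,
        show (((n - 1).toNat : ℕ) : ℤ) = n - 1 by omega, smul_neg, ← neg_smul,
        sub_add_cancel, ← Int.cast_smul_eq_zsmul ℂ]
      push_cast
      rfl
    · intro i hi
      rw [if_neg (by omega), if_neg (by omega)]
      simp

end Residues

section Zhu

variable (V : Type*) [AddCommGroup V] [Module ℂ V] [CFTTypeVOA V]
variable (W : Type*) [AddCommGroup W] [Module ℂ W] [AdmissibleModule V W]

open CFTTypeVOA (vac conf)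

/-- The subspace `O(W)`, spanned by `Res_z Y(a, z) w (1 + z)^(wt a) / z^2` for `a` homogeneous. -/
noncomputable def zhuO : Submodule ℂ W :=
  Submodule.span ℂ
    {x | ∃ n : ℕ, ∃ a ∈ CFTTypeVOA.grade (V := V) n, ∃ w : W, x = res n (-2) a w}

variable {V W}

theorem res_L_neg_one (k : ℕ) (N : ℤ) (a : V) (w : W) :
    res (k + 1) N (mode (W := V) 0 (conf : V) a) w =
      -(((k : ℂ) + 1) • res k N a w + (N : ℂ) • res (k + 1) (N - 1) a w) := by
  induction k generalizing N with
  | zero =>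
    simp only [res_succ, res_zero, mode_L_neg_one, add_sub_cancel_right, sub_add_cancel]
    push_cast
    module
  | succ k ih =>
    rw [res_succ, ih, ih, res_succ (k + 1) (N - 1), res_succ k N]
    simp only [add_sub_cancel_right, sub_add_cancel, res_succ k N]
    push_cast
    module

theorem res_mem_zhuO' (m : ℕ) {n : ℕ} {a : V} (ha : a ∈ CFTTypeVOA.grade n) (w : W) :
    res n (-2 - m) a w ∈ zhuO V W := by
  induction m generalizing n a with
  | zero =>
    refine Submodule.subset_span ⟨n, a, ha, w, by simp⟩
  | succ m ih =>
    have h1 : mode (W := V) 0 (conf : V) a ∈ CFTTypeVOA.grade (n + 1) :=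
      mode_mem (V := V) (W := V) CFTTypeVOA.conf_mem ha (by push_cast; ring)
    have h2 := ih h1
    rw [res_L_neg_one, res_succ, sub_add_cancel] at h2
    have h3 := ih ha
    have h4 : ((-2 - (m : ℤ) : ℤ) : ℂ) • res n (-2 - m - 1) a w ∈ zhuO V W := by
      convert (zhuO V W).sub_mem ((zhuO V W).neg_mem h2)
        ((zhuO V W).smul_mem ((n : ℂ) + 1 + ((-2 - (m : ℤ) : ℤ) : ℂ)) h3) using 1
      module
    rw [Submodule.smul_mem_iff _ (by exact_mod_cast (by omega : (-2 - (m : ℤ) : ℤ) ≠ 0))] at h4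
    convert h4 using 3
    push_cast
    ring_nf

/-- `Res_z Y(a, z) w (1 + z)^(wt a + j) / z^(2 + m)` lies in `O(W)` for `m ≥ j ≥ 0`. -/
theorem res_mem_zhuO {n j m k : ℕ} {N : ℤ} {a : V} (ha : a ∈ CFTTypeVOA.grade n) (w : W)
    (hk : k = n + j) (hN : N = -2 - m) (hj : j ≤ m) : res k N a w ∈ zhuO V W := by
  subst hk hN
  induction j generalizing m with
  | zero => exact res_mem_zhuO' m ha w
  | succ j ih =>
    obtain ⟨m, rfl⟩ := Nat.exists_eq_add_of_le' (show 1 ≤ m by omega)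
    rw [← add_assoc, res_succ]
    refine add_mem (ih (by omega)) ?_
    convert ih (m := m) (by omega) using 3
    push_cast
    ring_nf

theorem mode_cases {n l : ℕ} {a b : V} (ha : a ∈ CFTTypeVOA.grade n) (hb : b ∈ CFTTypeVOA.grade l)
    (t : ℤ) : mode (W := V) t a b = 0 ∨
      ∃ d : ℕ, (d : ℤ) = n + l - t - 1 ∧ mode (W := V) t a b ∈ CFTTypeVOA.grade d := by
  by_cases h : (n : ℤ) + l - t - 1 < 0
  · exact Or.inl (mode_eq_zero (W := V) ha hb h)
  · obtain ⟨d, hd⟩ := Int.eq_ofNat_of_zero_le (not_lt.1 h)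
    exact Or.inr ⟨d, hd.symm, mode_mem (W := V) ha hb hd.symm⟩

theorem finsum_mem_of_forall {E : Type*} [AddCommGroup E] [Module ℂ E] (S : Submodule ℂ E)
    {f : ℕ → E} (h : ∀ i, f i ∈ S) : ∑ᶠ i, f i ∈ S :=
  finsum_induction (· ∈ S) S.zero_mem (fun _ _ => S.add_mem) h

theorem comm_mem_zhuO {n l k k' g f : ℕ} {q : ℤ} {a b : V} (ha : a ∈ CFTTypeVOA.grade n)
    (hb : b ∈ CFTTypeVOA.grade l) (w : W) (hq : q = -1 - f) (hgf : g ≤ f)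
    (hk : k + k' + 1 = n + l + g) :
    res k (-1) a (res k' q b w) - res k' q b (res k (-1) a w) ∈ zhuO V W := by
  rw [res_comm]
  refine finsum_mem_of_forall _ fun u => zsmul_mem (sum_mem fun s hs => nsmul_mem ?_ _) _
  have hs' : s ≤ k := by simpa [Nat.lt_succ_iff] using hs
  rcases mode_cases ha hb (s + u) with h0 | ⟨d, hd, hm⟩
  · rw [h0]
    simp
  · exact res_mem_zhuO (j := u + g) (m := u + f) hm w (by omega) (by push_cast; omega) (by omega)

theorem res_truncate (a : V) (w : W) : ∃ T : ℕ, ∀ k : ℕ, ∀ n : ℤ, T ≤ n → res k n a w = 0 := by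
  obtain ⟨T, hT⟩ := mode_truncate a w
  refine ⟨T, fun k n hn => ?_⟩
  rw [res_apply]
  exact Finset.sum_eq_zero fun j _ => by rw [hT _ (by omega), smul_zero]

theorem negOnePow_mul_choose (i : ℕ) : (-1 : ℤ) ^ i * Ring.choose (-1 : ℤ) i = 1 := by
  rw [Ring.choose_neg', Ring.multichoose_one, Units.smul_def, smul_eq_mul, ← mul_assoc,
    Int.coe_negOnePow_natCast, ← mul_pow]
  simp

theorem circ_mem_zhuO {n l k' : ℕ} {a b : V} (ha : a ∈ CFTTypeVOA.grade n)
    (hb : b ∈ CFTTypeVOA.grade l) (w : W) (hk' : k' ≤ l + 1) (hk : l ≤ k') :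
    ∑ s ∈ Finset.range (n + 1), n.choose s •
      res (n - s + k') (-1) (mode (W := V) (-2 + s) a b) w ∈ zhuO V W := by
  rw [res_assoc]
  refine finsum_mem_of_forall _ fun i => zsmul_mem (sub_mem ?_ (zsmul_mem ?_ _)) _
  · exact res_mem_zhuO (j := 0) (m := i) ha _ (by omega) (by omega) (by omega)
  · exact res_mem_zhuO (j := k' - l) (m := i + 1) hb _ (by omega) (by push_cast; omega) (by omega)

theorem res_assoc_neg_one (a b : V) (w : W) (k l : ℕ) : ∃ N₀ : ℕ, ∀ N : ℕ, N₀ ≤ N →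
    ∑ s ∈ Finset.range (k + 1), k.choose s •
      res (k - s + l) (-1) (mode (W := V) (-1 + s) a b) w =
    ∑ i ∈ Finset.range N, (res k (-1 - i) a (res l (-1 + i) b w) +
      res l (-2 - i) b (res k i a w)) := by
  obtain ⟨T₁, h₁⟩ := res_truncate a w
  obtain ⟨T₂, h₂⟩ := res_truncate b w
  refine ⟨T₁ + T₂ + 1, fun N hN => ?_⟩
  rw [res_assoc]
  have h1 : ((-1 : ℤ).negOnePow : ℤ) = -1 := by rw [Int.negOnePow_odd _ (by decide)]; rfl
  simp only [negOnePow_mul_choose, h1, one_smul, neg_smul, sub_neg_eq_add, one_smul]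
  rw [finsum_eq_range N]
  · refine Finset.sum_congr rfl fun i _ => ?_
    norm_num
  · intro i hi
    rw [h₂ _ _ (by omega), h₁ _ _ (by omega)]
    simp

theorem assoc_left {n l : ℕ} {a b : V} (ha : a ∈ CFTTypeVOA.grade n)
    (hb : b ∈ CFTTypeVOA.grade l) (w : W) :
    ∑ s ∈ Finset.range (n + 1), n.choose s •
      res (n - s + l) (-1) (mode (W := V) (-1 + s) a b) w - res n (-1) a (res l (-1) b w) ∈
        zhuO V W := by
  obtain ⟨N, h⟩ := res_assoc_neg_one a b w n l
  rw [h (N + 1) (by omega), Finset.sum_add_distrib, Finset.sum_range_succ']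
  simp only [Nat.cast_zero, sub_zero, add_zero]
  rw [add_sub_right_comm, add_sub_cancel_right]
  refine add_mem (sum_mem fun i _ => ?_) (sum_mem fun i _ => ?_)
  · exact res_mem_zhuO (j := 0) (m := i) ha _ (by omega) (by push_cast; omega) (by omega)
  · exact res_mem_zhuO (j := 0) (m := i) hb _ (by omega) (by omega) (by omega)

theorem assoc_right {n l : ℕ} {a b : V} (ha : a ∈ CFTTypeVOA.grade (n + 1))
    (hb : b ∈ CFTTypeVOA.grade (l + 1)) (w : W) :
    ∑ s ∈ Finset.range (n + 1 + 1), (n + 1).choose s •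
      res (n + 1 - s + l) (-1) (mode (W := V) (-1 + s) a b) w -
        res l (-1) b (res n (-1) a w) ∈ zhuO V W := by
  obtain ⟨N₀, h⟩ := res_assoc_neg_one a b w (n + 1) l
  obtain ⟨T, hT⟩ := res_truncate a w
  obtain ⟨N, hN1, hN2⟩ : ∃ N : ℕ, N₀ ≤ N ∧ T ≤ N := ⟨N₀ + T, by omega, by omega⟩
  rw [h (N + 1) (by omega), Finset.sum_add_distrib, Finset.sum_range_succ' (n := N)]
  have h1 : ∑ i ∈ Finset.range N, res (n + 1) (-1 - (i + 1 : ℕ)) a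
      (res l (-1 + (i + 1 : ℕ)) b w) ∈ zhuO V W := sum_mem fun i _ =>
    res_mem_zhuO (j := 0) (m := i) ha _ (by omega) (by push_cast; omega) (by omega)
  have h2 : ∀ K : ℕ, ∑ i ∈ Finset.range K, res l (-2 - i) b (res (n + 1) i a w) +
      res l (-1) b (res n 0 a w) - res l (-1 - K) b (res n K a w) ∈ zhuO V W := by
    intro K
    induction K with
    | zero => simp
    | succ K ih =>
      rw [Finset.sum_range_succ]
      have h3 : res (l + 1) (-2 - K) b (res n K a w) ∈ zhuO V W :=
        res_mem_zhuO (j := 0) (m := K) hb _ (by omega) (by omega) (by omega)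
      rw [res_succ, show (-2 - (K : ℤ)) + 1 = -1 - K by ring] at h3
      convert add_mem ih h3 using 1
      rw [res_succ, map_add, show (-1 - ((K + 1 : ℕ) : ℤ)) = -2 - K by push_cast; ring]
      push_cast
      abel
  have h3 := h2 (N + 1)
  rw [hT n ((N + 1 : ℕ) : ℤ) (by push_cast; omega), map_zero, sub_zero] at h3
  have h4 : res (n + 1) (-1) a (res l (-1) b w) - res l (-1) b (res (n + 1) (-1) a w) ∈ zhuO V W :=
    comm_mem_zhuO (g := 0) (f := 0) ha hb w (by simp) le_rfl (by omega)
  rw [res_succ n (-1) a w, map_add] at h4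
  convert add_mem (add_mem h1 h3) h4 using 1
  simp only [Nat.cast_zero, sub_zero, add_zero, neg_add_cancel]
  abel

end Zhu

section Actions

variable {V : Type*} [AddCommGroup V] [Module ℂ V] [CFTTypeVOA V]
variable {W : Type*} [AddCommGroup W] [Module ℂ W] [AdmissibleModule V W]

open CFTTypeVOA (vac conf)

/-- The linear map on `V = ⨁ Vₙ` which is `f n` on `Vₙ`. -/
noncomputable def gradedLift {E : Type*} [AddCommGroup E] [Module ℂ E] (f : ℕ → V →ₗ[ℂ] E) :
    V →ₗ[ℂ] E :=
  DirectSum.toModule ℂ ℕ E (fun n => f n ∘ₗ (CFTTypeVOA.grade n).subtype) ∘ₗ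
    (LinearEquiv.ofBijective (DirectSum.coeLinearMap CFTTypeVOA.grade)
      (CFTTypeVOA.isInternal (V := V))).symm.toLinearMap

theorem gradedLift_of_mem {E : Type*} [AddCommGroup E] [Module ℂ E] (f : ℕ → V →ₗ[ℂ] E)
    {n : ℕ} {a : V} (ha : a ∈ CFTTypeVOA.grade n) : gradedLift f a = f n a := by
  have h : (LinearEquiv.ofBijective (DirectSum.coeLinearMap CFTTypeVOA.grade)
      (CFTTypeVOA.isInternal (V := V))).symm a =
        DirectSum.lof ℂ ℕ (fun n => CFTTypeVOA.grade (V := V) n) n ⟨a, ha⟩ := by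
    rw [LinearEquiv.symm_apply_eq]
    exact (DirectSum.coeLinearMap_lof CFTTypeVOA.grade n ⟨a, ha⟩).symm
  simp [gradedLift, h]

/-- The left action `a * w = Res_z Y(a, z) w (1 + z)^(wt a) / z = ∑ⱼ C(wt a, j) a_{j-1} w` for `a`
homogeneous, extended linearly to all `a ∈ V`. For `W = V` this is the product of Zhu's algebra. -/
noncomputable def leftMul : V →ₗ[ℂ] Module.End ℂ W :=
  gradedLift fun n => ∑ j ∈ Finset.range (n + 1), n.choose j • mode ((j : ℤ) - 1)

/-- The right action `w * a = Res_z Y(a, z) w (1 + z)^(wt a - 1) / z = ∑ⱼ C(wt a - 1, j) a_{j-1} w`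
for `a` homogeneous, extended linearly to all `a ∈ V`. The terms with `j > wt a` vanish: for
`wt a > 0` because of the binomial coefficient, and for `wt a = 0` because `a ∈ ℂ 𝟏`. -/
noncomputable def rightMul : V →ₗ[ℂ] Module.End ℂ W :=
  gradedLift fun n => ∑ j ∈ Finset.range (n + 1),
    Ring.choose ((n : ℤ) - 1) j • mode ((j : ℤ) - 1)

theorem leftMul_of_mem {n : ℕ} {a : V} (ha : a ∈ CFTTypeVOA.grade n) (w : W) :
    leftMul a w = res n (-1) a w := by
  rw [leftMul, gradedLift_of_mem _ ha, res]
  simp only [sub_eq_neg_add]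

theorem rightMul_of_mem_succ {n : ℕ} {a : V} (ha : a ∈ CFTTypeVOA.grade (n + 1)) (w : W) :
    rightMul a w = res n (-1) a w := by
  rw [rightMul, gradedLift_of_mem _ ha, res, Finset.sum_range_succ]
  simp [sub_eq_neg_add, Ring.choose_natCast]

theorem leftMul_vac (w : W) : leftMul (vac : V) w = w := by
  rw [leftMul_of_mem vac_mem, res_zero, mode_vac, if_pos rfl]

theorem rightMul_vac (w : W) : rightMul (vac : V) w = w := by
  rw [rightMul, gradedLift_of_mem _ vac_mem]
  simp [mode_vac]

theorem grade_induction {P : V → Prop} (h : ∀ n, ∀ a ∈ CFTTypeVOA.grade n, P a) (h0 : P 0)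
    (hadd : ∀ a b, P a → P b → P (a + b)) (a : V) : P a := by
  have : a ∈ ⨆ n, CFTTypeVOA.grade (V := V) n := by
    rw [CFTTypeVOA.isInternal.submodule_iSup_eq_top]
    trivial
  exact Submodule.iSup_induction _ (motive := P) this h h0 hadd

theorem leftMul_apply_vac (a : V) : leftMul a (vac : V) = a := by
  induction a using grade_induction with
  | h0 => simp
  | hadd a b ha hb => rw [map_add, LinearMap.add_apply, ha, hb]
  | h n a ha =>
    rw [leftMul_of_mem ha, res_apply, Finset.sum_eq_single 0]
    · rw [Nat.choose_zero_right, one_smul]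
      exact CFTTypeVOA.creation a
    · intro j _ hj
      rw [show mode (W := V) (-1 + (j : ℤ)) a vac = 0 from
        CFTTypeVOA.creation_nonneg a _ (by omega), smul_zero]
    · simp

/-- Induction on homogeneous vectors, separating the vacuum from positive weights. -/
theorem grade_induction' {P : V → Prop} (hv : P vac)
    (h : ∀ n, ∀ a ∈ CFTTypeVOA.grade (n + 1), P a) (h0 : P 0)
    (hadd : ∀ a b, P a → P b → P (a + b)) (hsmul : ∀ (c : ℂ) a, P a → P (c • a)) (a : V) :
    P a := by
  refine grade_induction (fun n a ha => ?_) h0 hadd a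
  cases n with
  | zero =>
    rw [CFTTypeVOA.grade_zero] at ha
    obtain ⟨c, rfl⟩ := Submodule.mem_span_singleton.1 ha
    exact hsmul c _ hv
  | succ n => exact h n a ha

theorem leftMul_mem (a : V) {w : W} (hw : w ∈ zhuO V W) : leftMul a w ∈ zhuO V W := by
  induction a using grade_induction with
  | h0 => simp
  | hadd a b ha hb => simpa using add_mem ha hb
  | h n a ha =>
    induction hw using Submodule.span_induction with
    | zero => simp
    | add x y _ _ hx hy => simpa using add_mem hx hy
    | smul c x _ hx => simpa using Submodule.smul_mem _ c hx
    | mem x hx =>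
      obtain ⟨l, b, hb, w, rfl⟩ := hx
      rw [leftMul_of_mem ha]
      have h1 := comm_mem_zhuO (k := n) (k' := l) (g := 1) (f := 1) (q := -2) ha hb w (by simp)
        le_rfl (by omega)
      have h2 : res l (-2) b (res n (-1) a w) ∈ zhuO V W :=
        Submodule.subset_span ⟨l, b, hb, _, rfl⟩
      simpa using add_mem h1 h2

theorem rightMul_mem (a : V) {w : W} (hw : w ∈ zhuO V W) : rightMul a w ∈ zhuO V W := by
  induction a using grade_induction' with
  | h0 => simp
  | hadd a b ha hb => simpa using add_mem ha hb
  | hsmul c a ha => simpa using Submodule.smul_mem _ c ha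
  | hv => rwa [rightMul_vac]
  | h n a ha =>
    induction hw using Submodule.span_induction with
    | zero => simp
    | add x y _ _ hx hy => simpa using add_mem hx hy
    | smul c x _ hx => simpa using Submodule.smul_mem _ c hx
    | mem x hx =>
      obtain ⟨l, b, hb, w, rfl⟩ := hx
      rw [rightMul_of_mem_succ ha]
      have h1 := comm_mem_zhuO (k := n) (k' := l) (g := 0) (f := 1) (q := -2) ha hb w (by simp)
        zero_le_one (by omega)
      have h2 : res l (-2) b (res n (-1) a w) ∈ zhuO V W :=
        Submodule.subset_span ⟨l, b, hb, _, rfl⟩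
      simpa using add_mem h1 h2

theorem leftMul_zhuO {a : V} (ha : a ∈ zhuO V V) (w : W) : leftMul a w ∈ zhuO V W := by
  induction ha using Submodule.span_induction with
  | zero => simp
  | add x y _ _ hx hy => simpa using add_mem hx hy
  | smul c x _ hx => simpa using Submodule.smul_mem _ c hx
  | mem x hx =>
    obtain ⟨n, a, ha, b, rfl⟩ := hx
    induction b using grade_induction with
    | h0 => simp
    | hadd a b ha hb => simpa using add_mem ha hb
    | h l b hb =>
      convert circ_mem_zhuO (k' := l + 1) ha hb w le_rfl (by omega) using 1
      rw [res_apply, map_sum, LinearMap.sum_apply]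
      refine Finset.sum_congr rfl fun s hs => ?_
      have := Finset.mem_range.1 hs
      rw [map_nsmul, LinearMap.smul_apply,
        leftMul_of_mem (mode_mem (W := V) (d := n - s + (l + 1)) ha hb (by omega))]

theorem rightMul_zhuO {a : V} (ha : a ∈ zhuO V V) (w : W) : rightMul a w ∈ zhuO V W := by
  induction ha using Submodule.span_induction with
  | zero => simp
  | add x y _ _ hx hy => simpa using add_mem hx hy
  | smul c x _ hx => simpa using Submodule.smul_mem _ c hx
  | mem x hx =>
    obtain ⟨n, a, ha, b, rfl⟩ := hx
    induction b using grade_induction with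
    | h0 => simp
    | hadd a b ha hb => simpa using add_mem ha hb
    | h l b hb =>
      convert circ_mem_zhuO (k' := l) ha hb w (by omega) le_rfl using 1
      rw [res_apply, map_sum, LinearMap.sum_apply]
      refine Finset.sum_congr rfl fun s hs => ?_
      have := Finset.mem_range.1 hs
      rw [map_nsmul, LinearMap.smul_apply,
        rightMul_of_mem_succ (mode_mem (W := V) (d := n - s + l + 1) ha hb (by omega))]

theorem leftMul_leftMul (a b : V) (w : W) :
    leftMul (leftMul a b) w - leftMul a (leftMul b w) ∈ zhuO V W := by
  induction a using grade_induction with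
  | h0 => simp
  | hadd a a' ha ha' =>
    convert add_mem ha ha' using 1
    simp only [map_add, LinearMap.add_apply]
    abel
  | h n a ha =>
    induction b using grade_induction with
    | h0 => simp
    | hadd b b' hb hb' =>
      convert add_mem hb hb' using 1
      simp only [map_add, LinearMap.add_apply]
      abel
    | h l b hb =>
      convert assoc_left ha hb w using 2
      · rw [leftMul_of_mem ha, res_apply, map_sum, LinearMap.sum_apply]
        refine Finset.sum_congr rfl fun s hs => ?_
        have := Finset.mem_range.1 hs
        rw [map_nsmul, LinearMap.smul_apply,
          leftMul_of_mem (mode_mem (W := V) (d := n - s + l) ha hb (by omega))]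
      · rw [leftMul_of_mem ha, leftMul_of_mem hb]

theorem leftMul_rightMul (a b : V) (w : W) :
    leftMul a (rightMul b w) - rightMul b (leftMul a w) ∈ zhuO V W := by
  induction b using grade_induction' with
  | h0 => simp
  | hadd b b' hb hb' =>
    convert add_mem hb hb' using 1
    simp only [map_add, LinearMap.add_apply]
    abel
  | hsmul c b hb =>
    convert Submodule.smul_mem _ c hb using 1
    simp only [map_smul, LinearMap.smul_apply, smul_sub]
  | hv => simp [rightMul_vac]
  | h l b hb =>
    induction a using grade_induction with
    | h0 => simp
    | hadd a a' ha ha' =>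
      convert add_mem ha ha' using 1
      simp only [map_add, LinearMap.add_apply]
      abel
    | h n a ha =>
      rw [rightMul_of_mem_succ hb, rightMul_of_mem_succ hb, leftMul_of_mem ha, leftMul_of_mem ha]
      exact comm_mem_zhuO (g := 0) (f := 0) ha hb w (by simp) le_rfl (by omega)

theorem rightMul_leftMul (a b : V) (w : W) :
    rightMul (leftMul a b) w - rightMul b (rightMul a w) ∈ zhuO V W := by
  induction a using grade_induction' with
  | h0 => simp
  | hadd a a' ha ha' =>
    convert add_mem ha ha' using 1
    simp only [map_add, LinearMap.add_apply]
    abel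
  | hsmul c b hb =>
    convert Submodule.smul_mem _ c hb using 1
    simp only [map_smul, LinearMap.smul_apply, smul_sub]
  | hv => simp [rightMul_vac, leftMul_vac]
  | h n a ha =>
    induction b using grade_induction' with
    | h0 => simp
    | hadd b b' hb hb' =>
      convert add_mem hb hb' using 1
      simp only [map_add, LinearMap.add_apply]
      abel
    | hsmul c b hb =>
      convert Submodule.smul_mem _ c hb using 1
      simp only [map_smul, LinearMap.smul_apply, smul_sub]
    | hv => simp [rightMul_vac, leftMul_apply_vac]
    | h l b hb =>
      convert assoc_right ha hb w using 2
      · rw [leftMul_of_mem ha, res_apply, map_sum, LinearMap.sum_apply]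
        refine Finset.sum_congr rfl fun s hs => ?_
        have := Finset.mem_range.1 hs
        rw [map_nsmul, LinearMap.smul_apply,
          rightMul_of_mem_succ (mode_mem (W := V) (d := n + 1 - s + l + 1) ha hb (by omega))]
      · rw [rightMul_of_mem_succ ha, rightMul_of_mem_succ hb]

end Actions

/-! ### Zhu's algebra and its bimodules -/

section Bimodules

open CFTTypeVOA (vac)

/-- Zhu's algebra `A(V) = V / O(V)`. -/
def ZhuAlgebra (V : Type*) [AddCommGroup V] [Module ℂ V] [CFTTypeVOA V] : Type _ :=
  V ⧸ zhuO V V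

/-- The `A(V)`-bimodule `A(W) = W / O(W)`. -/
def ZhuBimodule (V W : Type*) [AddCommGroup V] [Module ℂ V] [CFTTypeVOA V]
    [AddCommGroup W] [Module ℂ W] [AdmissibleModule V W] : Type _ :=
  W ⧸ zhuO V W

variable (V : Type*) [AddCommGroup V] [Module ℂ V] [CFTTypeVOA V]
variable (W : Type*) [AddCommGroup W] [Module ℂ W] [AdmissibleModule V W]

noncomputable instance : AddCommGroup (ZhuAlgebra V) := inferInstanceAs (AddCommGroup (V ⧸ zhuO V V))

noncomputable instance : Module ℂ (ZhuAlgebra V) := inferInstanceAs (Module ℂ (V ⧸ zhuO V V))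

noncomputable instance : AddCommGroup (ZhuBimodule V W) :=
  inferInstanceAs (AddCommGroup (W ⧸ zhuO V W))

noncomputable instance : Module ℂ (ZhuBimodule V W) := inferInstanceAs (Module ℂ (W ⧸ zhuO V W))

/-- The projection `V → A(V)`. -/
noncomputable def ZhuAlgebra.mk : V →ₗ[ℂ] ZhuAlgebra V := (zhuO V V).mkQ

/-- The projection `W → A(W)`. -/
noncomputable def ZhuBimodule.mk : W →ₗ[ℂ] ZhuBimodule V W := (zhuO V W).mkQ

variable {V W}

theorem ZhuAlgebra.mk_surjective : Function.Surjective (ZhuAlgebra.mk V) :=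
  Submodule.mkQ_surjective _

theorem ZhuBimodule.mk_surjective : Function.Surjective (ZhuBimodule.mk V W) :=
  Submodule.mkQ_surjective _

theorem ZhuBimodule.mk_eq {x y : W} (h : x - y ∈ zhuO V W) :
    ZhuBimodule.mk V W x = ZhuBimodule.mk V W y := (Submodule.Quotient.eq _).2 h

variable (V W)

/-- The left action of `A(V)` on `A(W)`, induced by `leftMul`. -/
noncomputable def zhuLeft : ZhuAlgebra V →ₗ[ℂ] Module.End ℂ (ZhuBimodule V W) :=
  (zhuO V V).liftQ
    { toFun := fun a => (zhuO V W).mapQ (zhuO V W) (leftMul a) fun _ hw => leftMul_mem a hw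
      map_add' := fun a b => by
        refine Submodule.linearMap_qext _ (LinearMap.ext fun w => ?_)
        change (zhuO V W).mkQ (leftMul (a + b) w) =
          (zhuO V W).mkQ (leftMul a w) + (zhuO V W).mkQ (leftMul b w)
        rw [map_add, LinearMap.add_apply, map_add]
      map_smul' := fun c a => by
        refine Submodule.linearMap_qext _ (LinearMap.ext fun w => ?_)
        change (zhuO V W).mkQ (leftMul (c • a) w) = c • (zhuO V W).mkQ (leftMul a w)
        rw [map_smul, LinearMap.smul_apply, map_smul] }
    fun a ha => by
      refine Submodule.linearMap_qext _ (LinearMap.ext fun w => ?_)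
      exact (Submodule.Quotient.mk_eq_zero _).2 (leftMul_zhuO ha w)

/-- The right action of `A(V)` on `A(W)`, induced by `rightMul`. -/
noncomputable def zhuRight : ZhuAlgebra V →ₗ[ℂ] Module.End ℂ (ZhuBimodule V W) :=
  (zhuO V V).liftQ
    { toFun := fun a => (zhuO V W).mapQ (zhuO V W) (rightMul a) fun _ hw => rightMul_mem a hw
      map_add' := fun a b => by
        refine Submodule.linearMap_qext _ (LinearMap.ext fun w => ?_)
        change (zhuO V W).mkQ (rightMul (a + b) w) =
          (zhuO V W).mkQ (rightMul a w) + (zhuO V W).mkQ (rightMul b w)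
        rw [map_add, LinearMap.add_apply, map_add]
      map_smul' := fun c a => by
        refine Submodule.linearMap_qext _ (LinearMap.ext fun w => ?_)
        change (zhuO V W).mkQ (rightMul (c • a) w) = c • (zhuO V W).mkQ (rightMul a w)
        rw [map_smul, LinearMap.smul_apply, map_smul] }
    fun a ha => by
      refine Submodule.linearMap_qext _ (LinearMap.ext fun w => ?_)
      exact (Submodule.Quotient.mk_eq_zero _).2 (rightMul_zhuO ha w)

variable {V W}

theorem zhuLeft_mk (a : V) (w : W) :
    zhuLeft V W (ZhuAlgebra.mk V a) (ZhuBimodule.mk V W w) = ZhuBimodule.mk V W (leftMul a w) := rfl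

theorem zhuRight_mk (a : V) (w : W) :
    zhuRight V W (ZhuAlgebra.mk V a) (ZhuBimodule.mk V W w) =
      ZhuBimodule.mk V W (rightMul a w) := rfl

/-- The product `a * b` of `A(V)`, induced by `leftMul`. -/
noncomputable instance : Mul (ZhuAlgebra V) := ⟨fun a b => zhuLeft V V a b⟩

noncomputable instance : One (ZhuAlgebra V) := ⟨ZhuAlgebra.mk V vac⟩

theorem ZhuAlgebra.mk_mul_mk (a b : V) :
    ZhuAlgebra.mk V a * ZhuAlgebra.mk V b = ZhuAlgebra.mk V (leftMul a b) := rfl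

theorem ZhuAlgebra.one_def : (1 : ZhuAlgebra V) = ZhuAlgebra.mk V vac := rfl

theorem zhuLeft_one (x : ZhuBimodule V W) : zhuLeft V W 1 x = x := by
  obtain ⟨w, rfl⟩ := ZhuBimodule.mk_surjective x
  rw [ZhuAlgebra.one_def, zhuLeft_mk, leftMul_vac]

theorem zhuRight_one (x : ZhuBimodule V W) : zhuRight V W 1 x = x := by
  obtain ⟨w, rfl⟩ := ZhuBimodule.mk_surjective x
  rw [ZhuAlgebra.one_def, zhuRight_mk, rightMul_vac]

theorem zhuLeft_mul (a b : ZhuAlgebra V) (x : ZhuBimodule V W) :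
    zhuLeft V W (a * b) x = zhuLeft V W a (zhuLeft V W b x) := by
  obtain ⟨a, rfl⟩ := ZhuAlgebra.mk_surjective a
  obtain ⟨b, rfl⟩ := ZhuAlgebra.mk_surjective b
  obtain ⟨w, rfl⟩ := ZhuBimodule.mk_surjective x
  exact ZhuBimodule.mk_eq (leftMul_leftMul a b w)

theorem zhuRight_mul (a b : ZhuAlgebra V) (x : ZhuBimodule V W) :
    zhuRight V W (a * b) x = zhuRight V W b (zhuRight V W a x) := by
  obtain ⟨a, rfl⟩ := ZhuAlgebra.mk_surjective a
  obtain ⟨b, rfl⟩ := ZhuAlgebra.mk_surjective b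
  obtain ⟨w, rfl⟩ := ZhuBimodule.mk_surjective x
  exact ZhuBimodule.mk_eq (rightMul_leftMul a b w)

theorem zhuLeft_zhuRight (a b : ZhuAlgebra V) (x : ZhuBimodule V W) :
    zhuLeft V W a (zhuRight V W b x) = zhuRight V W b (zhuLeft V W a x) := by
  obtain ⟨a, rfl⟩ := ZhuAlgebra.mk_surjective a
  obtain ⟨b, rfl⟩ := ZhuAlgebra.mk_surjective b
  obtain ⟨w, rfl⟩ := ZhuBimodule.mk_surjective x
  exact ZhuBimodule.mk_eq (leftMul_rightMul a b w)

noncomputable instance : Ring (ZhuAlgebra V) where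
  __ := (inferInstance : AddCommGroup (ZhuAlgebra V))
  left_distrib a b c := map_add (zhuLeft V V a) b c
  right_distrib a b c := LinearMap.congr_fun (map_add (zhuLeft V V) a b) c
  zero_mul a := LinearMap.congr_fun (map_zero (zhuLeft V V)) a
  mul_zero a := map_zero (zhuLeft V V a)
  mul_assoc a b c := zhuLeft_mul (W := V) a b c
  one_mul a := zhuLeft_one (W := V) a
  mul_one a := by
    obtain ⟨a, rfl⟩ := ZhuAlgebra.mk_surjective a
    rw [ZhuAlgebra.one_def, ZhuAlgebra.mk_mul_mk, leftMul_apply_vac]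

noncomputable instance : Algebra ℂ (ZhuAlgebra V) :=
  Algebra.ofModule (fun c a b => LinearMap.congr_fun (map_smul (zhuLeft V V) c a) b)
    (fun c a b => map_smul (zhuLeft V V a) c b)

/-- `A(W)` as a left `A(V)`-module. -/
noncomputable instance : Module (ZhuAlgebra V) (ZhuBimodule V W) where
  smul a x := zhuLeft V W a x
  one_smul := zhuLeft_one
  mul_smul := zhuLeft_mul
  smul_zero a := map_zero (zhuLeft V W a)
  smul_add a := map_add (zhuLeft V W a)
  add_smul a b x := LinearMap.congr_fun (map_add (zhuLeft V W) a b) x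
  zero_smul x := LinearMap.congr_fun (map_zero (zhuLeft V W)) x

/-- `A(W)` as a right `A(V)`-module. -/
noncomputable instance : Module (ZhuAlgebra V)ᵐᵒᵖ (ZhuBimodule V W) where
  smul a x := zhuRight V W a.unop x
  one_smul := zhuRight_one
  mul_smul a b := zhuRight_mul b.unop a.unop
  smul_zero a := map_zero (zhuRight V W a.unop)
  smul_add a := map_add (zhuRight V W a.unop)
  add_smul a b x := LinearMap.congr_fun (map_add (zhuRight V W) a.unop b.unop) x
  zero_smul x := LinearMap.congr_fun (map_zero (zhuRight V W)) x

instance : SMulCommClass (ZhuAlgebra V) (ZhuAlgebra V)ᵐᵒᵖ (ZhuBimodule V W) :=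
  ⟨fun a b x => zhuLeft_zhuRight a b.unop x⟩

instance : IsScalarTower ℂ (ZhuAlgebra V) (ZhuBimodule V W) :=
  ⟨fun c a x => LinearMap.congr_fun (map_smul (zhuLeft V W) c a) x⟩

instance : IsScalarTower ℂ (ZhuAlgebra V)ᵐᵒᵖ (ZhuBimodule V W) :=
  ⟨fun c a x => LinearMap.congr_fun (map_smul (zhuRight V W) c a.unop) x⟩

end Bimodules

/-! ### Tensor products of bimodules -/

section Balanced

set_option linter.unusedSectionVars false

open scoped TensorProduct

variable (A X Y : Type*) [Ring A] [Algebra ℂ A]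
  [AddCommGroup X] [Module ℂ X] [Module A X] [Module Aᵐᵒᵖ X]
  [AddCommGroup Y] [Module ℂ Y] [Module A Y] [Module Aᵐᵒᵖ Y]

/-- The subspace of `X ⊗_ℂ Y` spanned by the elements `x a ⊗ y - x ⊗ a y`. -/
def balancedRel : Submodule ℂ (X ⊗[ℂ] Y) :=
  Submodule.span ℂ {t | ∃ (x : X) (a : A) (y : Y),
    t = (MulOpposite.op a • x) ⊗ₜ[ℂ] y - x ⊗ₜ[ℂ] (a • y)}

/-- The tensor product `X ⊗_A Y` of bimodules over a `ℂ`-algebra `A`. -/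
def BalancedTensor : Type _ := (X ⊗[ℂ] Y) ⧸ balancedRel A X Y

noncomputable instance : AddCommGroup (BalancedTensor A X Y) :=
  inferInstanceAs (AddCommGroup ((X ⊗[ℂ] Y) ⧸ balancedRel A X Y))

noncomputable instance : Module ℂ (BalancedTensor A X Y) :=
  inferInstanceAs (Module ℂ ((X ⊗[ℂ] Y) ⧸ balancedRel A X Y))

/-- The projection `X ⊗_ℂ Y → X ⊗_A Y`. -/
noncomputable def BalancedTensor.mk : X ⊗[ℂ] Y →ₗ[ℂ] BalancedTensor A X Y :=
  (balancedRel A X Y).mkQ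

variable {X Y} in
/-- The element `x ⊗ y` of `X ⊗_A Y`. -/
noncomputable def BalancedTensor.tmul (x : X) (y : Y) : BalancedTensor A X Y :=
  BalancedTensor.mk A X Y (x ⊗ₜ[ℂ] y)

variable {A X Y}

theorem BalancedTensor.add_tmul (x x' : X) (y : Y) :
    tmul A (x + x') y = tmul A x y + tmul A x' y := by
  rw [tmul, TensorProduct.add_tmul, map_add]
  rfl

theorem BalancedTensor.tmul_add (x : X) (y y' : Y) :
    tmul A x (y + y') = tmul A x y + tmul A x y' := by
  rw [tmul, TensorProduct.tmul_add, map_add]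
  rfl

theorem BalancedTensor.smul_tmul (c : ℂ) (x : X) (y : Y) :
    tmul A (c • x) y = c • tmul A x y := by
  rw [tmul, ← TensorProduct.smul_tmul', map_smul]
  rfl

theorem BalancedTensor.tmul_smul (c : ℂ) (x : X) (y : Y) :
    tmul A x (c • y) = c • tmul A x y := by
  rw [tmul, TensorProduct.tmul_smul, map_smul]
  rfl

theorem BalancedTensor.zero_tmul (y : Y) : tmul A (0 : X) y = 0 := by
  rw [tmul, TensorProduct.zero_tmul, map_zero]

theorem BalancedTensor.tmul_zero (x : X) : tmul A x (0 : Y) = 0 := by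
  rw [tmul, TensorProduct.tmul_zero, map_zero]

theorem BalancedTensor.hom_ext {E : Type*} [AddCommGroup E] [Module ℂ E]
    {f g : BalancedTensor A X Y →ₗ[ℂ] E}
    (h : ∀ x y, f (BalancedTensor.tmul A x y) = g (BalancedTensor.tmul A x y)) : f = g :=
  Submodule.linearMap_qext _ (TensorProduct.ext' h)

variable [IsScalarTower ℂ A X] [SMulCommClass A Aᵐᵒᵖ X]
  [IsScalarTower ℂ Aᵐᵒᵖ Y] [SMulCommClass A Aᵐᵒᵖ Y]

variable (X Y) in
/-- The left action of `A` on `X ⊗_A Y`, `a (x ⊗ y) = (a x) ⊗ y`. -/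
noncomputable def balancedLeft (a : A) : Module.End ℂ (BalancedTensor A X Y) :=
  (balancedRel A X Y).mapQ (balancedRel A X Y) (LinearMap.rTensor Y (Algebra.lsmul ℂ ℂ X a)) <|
    Submodule.span_le.2 <| by
      rintro _ ⟨x, b, y, rfl⟩
      refine Submodule.subset_span ⟨a • x, b, y, ?_⟩
      simp [smul_comm a]

variable (X Y) in
/-- The right action of `A` on `X ⊗_A Y`, `(x ⊗ y) a = x ⊗ (y a)`. -/
noncomputable def balancedRight (a : Aᵐᵒᵖ) : Module.End ℂ (BalancedTensor A X Y) :=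
  (balancedRel A X Y).mapQ (balancedRel A X Y) (LinearMap.lTensor X (Algebra.lsmul ℂ ℂ Y a)) <|
    Submodule.span_le.2 <| by
      rintro _ ⟨x, b, y, rfl⟩
      refine Submodule.subset_span ⟨x, b, a • y, ?_⟩
      simp [smul_comm b]

theorem balancedLeft_tmul (a : A) (x : X) (y : Y) :
    balancedLeft X Y a (BalancedTensor.tmul A x y) = BalancedTensor.tmul A (a • x) y := rfl

theorem balancedRight_tmul (a : Aᵐᵒᵖ) (x : X) (y : Y) :
    balancedRight X Y a (BalancedTensor.tmul A x y) = BalancedTensor.tmul A x (a • y) := rfl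

noncomputable instance : Module A (BalancedTensor A X Y) where
  smul a t := balancedLeft X Y a t
  one_smul t := by
    have : balancedLeft X Y (1 : A) = LinearMap.id :=
      BalancedTensor.hom_ext fun x y => by simp [balancedLeft_tmul]
    exact LinearMap.congr_fun this t
  mul_smul a b t := by
    have : balancedLeft X Y (a * b) = balancedLeft X Y a ∘ₗ balancedLeft X Y b :=
      BalancedTensor.hom_ext fun x y => by simp [balancedLeft_tmul, mul_smul]
    exact LinearMap.congr_fun this t
  smul_zero a := map_zero (balancedLeft X Y a)
  smul_add a := map_add (balancedLeft X Y a)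
  add_smul a b t := by
    have : balancedLeft X Y (a + b) = balancedLeft X Y a + balancedLeft X Y b :=
      BalancedTensor.hom_ext fun x y => by
        simp [balancedLeft_tmul, add_smul, BalancedTensor.add_tmul]
    exact LinearMap.congr_fun this t
  zero_smul t := by
    have : balancedLeft X Y (0 : A) = 0 :=
      BalancedTensor.hom_ext fun x y => by simp [balancedLeft_tmul, BalancedTensor.zero_tmul]
    exact LinearMap.congr_fun this t

noncomputable instance : Module Aᵐᵒᵖ (BalancedTensor A X Y) where
  smul a t := balancedRight X Y a t
  one_smul t := by
    have : balancedRight X Y (1 : Aᵐᵒᵖ) = LinearMap.id :=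
      BalancedTensor.hom_ext fun x y => by simp [balancedRight_tmul]
    exact LinearMap.congr_fun this t
  mul_smul a b t := by
    have : balancedRight X Y (a * b) = balancedRight X Y a ∘ₗ balancedRight X Y b :=
      BalancedTensor.hom_ext fun x y => by simp [balancedRight_tmul, mul_smul]
    exact LinearMap.congr_fun this t
  smul_zero a := map_zero (balancedRight X Y a)
  smul_add a := map_add (balancedRight X Y a)
  add_smul a b t := by
    have : balancedRight X Y (a + b) = balancedRight X Y a + balancedRight X Y b :=
      BalancedTensor.hom_ext fun x y => by
        simp [balancedRight_tmul, add_smul, BalancedTensor.tmul_add]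
    exact LinearMap.congr_fun this t
  zero_smul t := by
    have : balancedRight X Y (0 : Aᵐᵒᵖ) = 0 :=
      BalancedTensor.hom_ext fun x y => by simp [balancedRight_tmul, BalancedTensor.tmul_zero]
    exact LinearMap.congr_fun this t

instance : SMulCommClass A Aᵐᵒᵖ (BalancedTensor A X Y) where
  smul_comm a b t := by
    have : balancedLeft X Y a ∘ₗ balancedRight X Y b = balancedRight X Y b ∘ₗ balancedLeft X Y a :=
      BalancedTensor.hom_ext fun x y => by simp [balancedLeft_tmul, balancedRight_tmul]
    exact LinearMap.congr_fun this t

instance : IsScalarTower ℂ A (BalancedTensor A X Y) where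
  smul_assoc c a t := by
    have : balancedLeft X Y (c • a) = c • balancedLeft X Y a :=
      BalancedTensor.hom_ext fun x y => by
        simp [balancedLeft_tmul, BalancedTensor.smul_tmul]
    exact LinearMap.congr_fun this t

instance : IsScalarTower ℂ Aᵐᵒᵖ (BalancedTensor A X Y) where
  smul_assoc c a t := by
    have : balancedRight X Y (c • a) = c • balancedRight X Y a :=
      BalancedTensor.hom_ext fun x y => by
        simp [balancedRight_tmul, BalancedTensor.tmul_smul]
    exact LinearMap.congr_fun this t

/-- The left module structure of `X ⊗_A Y` over `A ⊗_ℂ A^op`, `(a ⊗ b) t = a t b`. -/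
noncomputable instance balancedTensorModule : Module (A ⊗[ℂ] Aᵐᵒᵖ) (BalancedTensor A X Y) :=
  TensorProduct.Algebra.module

theorem balancedTensorModule_tmul_smul (a b : A) (x : X) (y : Y) :
    (a ⊗ₜ[ℂ] MulOpposite.op b : A ⊗[ℂ] Aᵐᵒᵖ) • BalancedTensor.tmul A x y =
      BalancedTensor.tmul A (a • x) (MulOpposite.op b • y) := rfl

instance : IsScalarTower ℂ (A ⊗[ℂ] Aᵐᵒᵖ) (BalancedTensor A X Y) where
  smul_assoc c s t := by
    change TensorProduct.Algebra.moduleAux (c • s) t = c • TensorProduct.Algebra.moduleAux s t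
    rw [map_smul, LinearMap.smul_apply]

end Balanced

/-! ### Filtrations and strong generation -/

section Filtrations

/-- The subspace `S x = {s x | s ∈ S}`, for a subspace `S` of an algebra `R` and an element `x` of
an `R`-module. -/
def subspaceSMul {R T : Type*} [Ring R] [Algebra ℂ R] [AddCommGroup T] [Module ℂ T] [Module R T]
    [IsScalarTower ℂ R T] (S : Submodule ℂ R) (x : T) : Submodule ℂ T :=
  S.map ((LinearMap.toSpanSingleton R T x).restrictScalars ℂ)

open scoped TensorProduct

variable (V : Type*) [AddCommGroup V] [Module ℂ V] [CFTTypeVOA V]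
variable (M : Type*) [AddCommGroup M] [Module ℂ M] [AdmissibleModule V M]
variable (N : Type*) [AddCommGroup N] [Module ℂ N] [AdmissibleModule V N]

/-- The filtration `A(V)_n`, the image of `V₀ ⊕ ⋯ ⊕ V_n` in `A(V)`. -/
noncomputable def algFiltration (n : ℕ) : Submodule ℂ (ZhuAlgebra V) :=
  (⨆ i ≤ n, CFTTypeVOA.grade i).map (ZhuAlgebra.mk V)

/-- The filtration `A(M)_n`, the image of `M(0) ⊕ ⋯ ⊕ M(n)` in `A(M)`. -/
noncomputable def modFiltration (n : ℕ) : Submodule ℂ (ZhuBimodule V M) :=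
  (⨆ i ≤ n, AdmissibleModule.grade V i).map (ZhuBimodule.mk V M)

/-- The filtration of `A(V) ⊗_ℂ A(V)^op`. -/
noncomputable def envFiltration (n : ℕ) : Submodule ℂ (ZhuAlgebra V ⊗[ℂ] (ZhuAlgebra V)ᵐᵒᵖ) :=
  Submodule.span ℂ {t | ∃ k l : ℕ, k + l ≤ n ∧ ∃ a ∈ algFiltration V k, ∃ b ∈ algFiltration V l,
    t = a ⊗ₜ[ℂ] MulOpposite.op b}

/-- The filtration of `A(M) ⊗_{A(V)} A(N)`. -/
noncomputable def tensorFiltration (n : ℕ) :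
    Submodule ℂ (BalancedTensor (ZhuAlgebra V) (ZhuBimodule V M) (ZhuBimodule V N)) :=
  Submodule.span ℂ {t | ∃ k l : ℕ, k + l ≤ n ∧ ∃ x ∈ modFiltration V M k,
    ∃ y ∈ modFiltration V N l, t = BalancedTensor.tmul (ZhuAlgebra V) x y}

variable {M} in
/-- The elements `a¹_{-n₁} ⋯ aᵏ_{-n_k} w` of `M`, where `k ≥ 0`, `aⁱ ∈ V₊` is homogeneous,
`nᵢ ≥ 1` and `w ∈ S`. -/
inductive StrongMonomial (S : Set M) : M → Prop
  | base (w : M) (hw : w ∈ S) : StrongMonomial S w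
  | step (d : ℕ) (hd : 1 ≤ d) (a : V) (ha : a ∈ CFTTypeVOA.grade d) (n : ℕ) (hn : 1 ≤ n) (x : M)
      (hx : StrongMonomial S x) : StrongMonomial S (mode (-(n : ℤ)) a x)

variable {M} in
/-- `M` is strongly generated by the subset `S`. -/
def StronglyGeneratedBy (S : Set M) : Prop :=
  Submodule.span ℂ {x | StrongMonomial V S x} = ⊤

end Filtrations

end VOA

namespace VOA

variable {V : Type*} [AddCommGroup V] [Module ℂ V] [CFTTypeVOA V]
variable {W : Type*} [AddCommGroup W] [Module ℂ W] [AdmissibleModule V W]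

open AdmissibleModule (grade)

/-! ### The filtrations are multiplicative -/

/-! The bottom level generates the filtration of $A(W)$ from either side: if $W$ is strongly
generated by $W(0)$, then $A(W)_k$ lies in both $A(V)_k * A(W)_0$ and $A(W)_0 * A(V)_k$. These are
`StronglyGeneratedBy.modFiltration_le_left` and `StronglyGeneratedBy.modFiltration_le_right`. Using
the left form for $M$ and the right form for $N$, an element $x \otimes y$ with $x \in A(M)_k$ and
$y \in A(N)_l$ becomes a combination of elements $(a * u_i) \otimes (v_j * b) = (a \otimes b).(u_i
\otimes v_j)$ with $a \in A(V)_k$ and $b \in A(V)_l$. The reverse inclusion only needs that both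
actions add filtration degrees: `zhuLeft_mem_modFiltration` and `zhuRight_mem_modFiltration`.

The generation statement is an induction on degree. By `StronglyGeneratedBy.grade_le_span`, for $k >
0$ the space $W(k)$ is spanned by vectors $a_{-n}x$ with $a \in V_d$, $x \in W(p)$, $d, n \ge 1$ and
$k = d + p + n - 1$. Such a vector is the top-degree term of $\mathrm{Res}_z\, Y(a,z)x\,(1+z)^K
z^{-n}$ for every $K$, since the other terms $a_{-n+j}x$ with $j \ge 1$ have degree $k - j$.

If $n \ge 2$, the residue with $K = d$ lies in $O(W)$, so in $A(W)$ the vector reduces to lower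
degree. If $n = 1$, the residue is $a * x$ for $K = d$ and $x * a$ for $K = d - 1$. Here $p < k$
because $d \ge 1$, so the induction hypothesis applies to $x$, and associativity of the action
absorbs $a$ into the coefficient from $A(V)$. `StronglyGeneratedBy.mk_mem` runs this induction for
both sides at once. -/

theorem grade_le_iSup {i n : ℕ} (h : i ≤ n) :
    grade V (W := W) i ≤ ⨆ i ≤ n, grade V (W := W) i :=
  le_iSup₂_of_le i h le_rfl

/-- Both actions are combinations of the modes $a_{j-1}$ with $j \ge 0$. Such a mode sends $W(p)$ to
degree $d + p - j$, which is at most $d + p$; when $j > d + p$ the degree is negative and the mode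
vanishes. -/
theorem mode_mem_iSup {d p : ℕ} {a : V} {w : W} (ha : a ∈ CFTTypeVOA.grade d)
    (hw : w ∈ grade V p) (j : ℕ) : mode ((j : ℤ) - 1) a w ∈ ⨆ i ≤ d + p, grade V (W := W) i := by
  by_cases h : j ≤ d + p
  · exact grade_le_iSup (Nat.sub_le (d + p) j) (mode_mem ha hw (by omega))
  · rw [mode_eq_zero ha hw (by omega)]
    exact zero_mem _

theorem leftMul_mem_iSup {d p : ℕ} {a : V} {w : W} (ha : a ∈ CFTTypeVOA.grade d)
    (hw : w ∈ grade V p) : leftMul a w ∈ ⨆ i ≤ d + p, grade V (W := W) i := by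
  rw [leftMul, gradedLift_of_mem _ ha]
  simp only [LinearMap.sum_apply, LinearMap.smul_apply]
  exact sum_mem fun j _ => nsmul_mem (mode_mem_iSup ha hw j) _

theorem rightMul_mem_iSup {d p : ℕ} {a : V} {w : W} (ha : a ∈ CFTTypeVOA.grade d)
    (hw : w ∈ grade V p) : rightMul a w ∈ ⨆ i ≤ d + p, grade V (W := W) i := by
  rw [rightMul, gradedLift_of_mem _ ha]
  simp only [LinearMap.sum_apply, LinearMap.smul_apply]
  exact sum_mem fun j _ => zsmul_mem (mode_mem_iSup ha hw j) _

/-- `Submodule.map₂` commutes with suprema in each argument, so a degree bound for a bilinear map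
need only be checked on homogeneous pairs. It is applied to `leftMul` and to `rightMul`. -/
theorem map₂_iSup_le {E F G : Type*} [AddCommGroup E] [Module ℂ E] [AddCommGroup F] [Module ℂ F]
    [AddCommGroup G] [Module ℂ G] (f : E →ₗ[ℂ] F →ₗ[ℂ] G) {P : ℕ → Submodule ℂ E}
    {Q : ℕ → Submodule ℂ F} {R : ℕ → Submodule ℂ G} {k l : ℕ}
    (h : ∀ d p, ∀ a ∈ P d, ∀ w ∈ Q p, f a w ∈ ⨆ i ≤ d + p, R i) :
    Submodule.map₂ f (⨆ i ≤ k, P i) (⨆ i ≤ l, Q i) ≤ ⨆ i ≤ k + l, R i := by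
  simp only [Submodule.map₂_iSup_left, Submodule.map₂_iSup_right, iSup_le_iff]
  intro p hp d hd
  refine Submodule.map₂_le.2 fun a ha w hw => ?_
  have hle : ⨆ i ≤ d + p, R i ≤ ⨆ i ≤ k + l, R i :=
    biSup_mono fun _ hi => hi.trans (add_le_add hd hp)
  exact hle (h d p a ha w hw)

theorem zhuLeft_mem_modFiltration {k l : ℕ} {a : ZhuAlgebra V} {x : ZhuBimodule V W}
    (ha : a ∈ algFiltration V k) (hx : x ∈ modFiltration V W l) :
    zhuLeft V W a x ∈ modFiltration V W (k + l) := by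
  obtain ⟨a, ha, rfl⟩ := ha
  obtain ⟨w, hw, rfl⟩ := hx
  exact ⟨leftMul a w, map₂_iSup_le leftMul (fun d p a ha w hw => leftMul_mem_iSup ha hw)
    (Submodule.apply_mem_map₂ _ ha hw), rfl⟩

theorem zhuRight_mem_modFiltration {k l : ℕ} {a : ZhuAlgebra V} {x : ZhuBimodule V W}
    (ha : a ∈ algFiltration V k) (hx : x ∈ modFiltration V W l) :
    zhuRight V W a x ∈ modFiltration V W (k + l) := by
  obtain ⟨a, ha, rfl⟩ := ha
  obtain ⟨w, hw, rfl⟩ := hx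
  exact ⟨rightMul a w, map₂_iSup_le rightMul (fun d p a ha w hw => rightMul_mem_iSup ha hw)
    (Submodule.apply_mem_map₂ _ ha hw), rfl⟩

/-- This is the bound for the left action in the adjoint module: for $W = V$ the bimodule, its
filtration and its left action unfold to $A(V)$, $A(V)_n$ and the product. -/
theorem mul_mem_algFiltration {k l : ℕ} {a b : ZhuAlgebra V} (ha : a ∈ algFiltration V k)
    (hb : b ∈ algFiltration V l) : a * b ∈ algFiltration V (k + l) :=
  zhuLeft_mem_modFiltration (W := V) ha hb

theorem algFiltration_mono : Monotone (algFiltration V) := fun _ _ h =>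
  Submodule.map_mono (biSup_mono fun _ hi => hi.trans h)

theorem mk_mem_algFiltration {d : ℕ} {a : V} (ha : a ∈ CFTTypeVOA.grade d) :
    ZhuAlgebra.mk V a ∈ algFiltration V d := by
  have h : CFTTypeVOA.grade (V := V) d ≤ ⨆ i ≤ d, CFTTypeVOA.grade i :=
    le_iSup₂_of_le d le_rfl le_rfl
  exact ⟨a, h ha, rfl⟩

theorem one_mem_algFiltration (k : ℕ) : (1 : ZhuAlgebra V) ∈ algFiltration V k :=
  algFiltration_mono (Nat.zero_le k) (mk_mem_algFiltration vac_mem)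

theorem modFiltration_zero :
    modFiltration V W 0 = (grade V (W := W) 0).map (ZhuBimodule.mk V W) := by
  simp [modFiltration]

/-! ### Homogeneous components of strongly generated modules -/

/-- Modular law: $G_k$ is its own intersection with $F_k + \sum_{j \ne k} F_j$, and since $F_k \le
G_k$ this intersection is $F_k + (\sum_{j\ne k} F_j) \cap G_k$. The last term vanishes because $F_j
\le G_j$ and the $G_j$ are independent. -/
theorem eq_of_le_of_iSupIndep {E : Type*} [AddCommGroup E] [Module ℂ E] {F G : ℕ → Submodule ℂ E}
    (hG : iSupIndep G) (hF : ∀ i, F i ≤ G i) (h : ⨆ i, F i = ⊤) (k : ℕ) : F k = G k := by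
  refine le_antisymm (hF k) ?_
  have h1 : (⨆ j ≠ k, F j) ⊓ G k = ⊥ :=
    ((hG k).mono_right (iSup₂_mono fun j _ => hF j)).symm.eq_bot
  have h2 : F k ⊔ ⨆ j ≠ k, F j = ⊤ := by rw [← h, iSup_split_single F k]
  calc G k = (F k ⊔ ⨆ j ≠ k, F j) ⊓ G k := by rw [h2, top_inf_eq]
    _ = F k ⊔ (⨆ j ≠ k, F j) ⊓ G k := sup_inf_assoc_of_le _ (hF k)
    _ ≤ F k := by rw [h1, sup_bot_eq]

variable (V W) in
/-- The elements `a_{-n} x` of `W(k)`, where `a ∈ V₊` and `x ∈ W` are homogeneous and `n ≥ 1`. -/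
def creationSet (k : ℕ) : Set W :=
  {y | ∃ d p n : ℕ, 1 ≤ d ∧ 1 ≤ n ∧ k + 1 = d + p + n ∧ ∃ a ∈ CFTTypeVOA.grade (V := V) d,
    ∃ x ∈ grade V (W := W) p, y = mode (-(n : ℤ)) a x}

/-- Monomials in homogeneous modes applied to bottom vectors are homogeneous. Only the outermost
mode is recorded; the rest of the monomial is kept merely as a homogeneous vector. The alternative
$k = 0$ covers monomials of length zero. -/
theorem StrongMonomial.mem_creationSet {x : W}
    (hx : StrongMonomial V (grade V (W := W) 0 : Set W) x) :
    ∃ k, x ∈ grade V k ∧ (x ∈ creationSet V W k ∨ k = 0) := by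
  induction hx with
  | base w hw => exact ⟨0, hw, Or.inr rfl⟩
  | step d hd a ha n hn x _ ih =>
    obtain ⟨p, hp, -⟩ := ih
    exact ⟨d + p + n - 1, mode_mem ha hp (by omega),
      Or.inl ⟨d, p, n, hd, hn, by omega, a, ha, x, hp, rfl⟩⟩

/-- Strong generation only says that the monomials span all of $W$. Because they are homogeneous,
directness of the grading forces those of degree $k$ to span $W(k)$. -/
theorem StronglyGeneratedBy.grade_le_span (h : StronglyGeneratedBy V (grade V (W := W) 0 : Set W))
    {k : ℕ} (hk : k ≠ 0) : grade V (W := W) k ≤ Submodule.span ℂ (creationSet V W k) := by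
  -- The second set is nonempty only for $k = 0$: it supplies the bottom vectors, which are not of
  -- the form $a_{-n}x$, so that the $F_k$ together span $W$.
  let F : ℕ → Submodule ℂ W := fun k =>
    Submodule.span ℂ (creationSet V W k ∪ {x | k = 0 ∧ x ∈ grade V (W := W) 0})
  have hF : ∀ k, F k ≤ grade V k := by
    refine fun k => Submodule.span_le.2 ?_
    rintro _ (⟨d, p, n, hd, hn, hk, a, ha, x, hx, rfl⟩ | ⟨rfl, hx⟩)
    · exact mode_mem ha hx (by omega)
    · exact hx
  have hT : ⨆ k, F k = ⊤ := by
    refine top_le_iff.1 (h ▸ Submodule.span_le.2 fun x hx => ?_)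
    obtain ⟨k, hxk, hx⟩ := StrongMonomial.mem_creationSet hx
    refine Submodule.mem_iSup_of_mem k (Submodule.subset_span ?_)
    rcases hx with hx | rfl
    · exact Or.inl hx
    · exact Or.inr ⟨rfl, hxk⟩
  rw [← eq_of_le_of_iSupIndep
    (AdmissibleModule.isInternal (V := V) (W := W)).submodule_iSupIndep hF hT k]
  simp [F, hk]

/-! ### Generation by the bottom level -/

/-- Modulo lower degrees the residue equals its $j = 0$ term, whose coefficient $\binom{K}{0}$ is 1
whatever $K$ is. This freedom in $K$ lets one lemma serve the left action, the right action and the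
elements of $O(W)$. -/
theorem map_mode_mem_of_map_res_mem {E : Type*} [AddCommGroup E] [Module ℂ E] (φ : W →ₗ[ℂ] E)
    {S : Submodule ℂ E} {k d p n : ℕ} (hk : k + 1 = d + p + n)
    (hS : ∀ i < k, ∀ w ∈ grade V (W := W) i, φ w ∈ S) {a : V} {x : W}
    (ha : a ∈ CFTTypeVOA.grade d) (hx : x ∈ grade V p) (K : ℕ)
    (h : φ (res K (-(n : ℤ)) a x) ∈ S) : φ (mode (-(n : ℤ)) a x) ∈ S := by
  rw [res_apply, Finset.sum_range_succ', map_add, Submodule.add_mem_iff_right] at h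
  · simpa using h
  · rw [map_sum]
    refine sum_mem fun j _ => ?_
    rw [map_nsmul]
    refine nsmul_mem ?_ _
    -- After the index shift the term is $a_{-n+j+1}x$, of degree $k - (j+1)$; it is zero if this
    -- degree is negative.
    by_cases hj : j + 1 ≤ k
    · exact hS (k - (j + 1)) (by omega) _ (mode_mem ha hx (by push_cast; omega))
    · rw [mode_eq_zero ha hx (by push_cast; omega), map_zero]
      exact zero_mem _

/-- If `S` is an increasing family of subspaces of `A(W)` such that `S 0` contains the image of
`W(0)` and the operators `Res_z Y(a, z) (1 + z)^(K (wt a)) / z` raise the index by at most `wt a`,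
then `S k` contains the image of `W(k)`. -/
theorem StronglyGeneratedBy.mk_mem (h : StronglyGeneratedBy V (grade V (W := W) 0 : Set W))
    {S : ℕ → Submodule ℂ (ZhuBimodule V W)} (hmono : Monotone S)
    (h0 : ∀ w ∈ grade V (W := W) 0, ZhuBimodule.mk V W w ∈ S 0) (K : ℕ → ℕ)
    (hstep : ∀ d p, 1 ≤ d → ∀ a ∈ CFTTypeVOA.grade (V := V) d, ∀ x : W,
      ZhuBimodule.mk V W x ∈ S p → ZhuBimodule.mk V W (res (K d) (-1) a x) ∈ S (d + p))
    (k : ℕ) : ∀ w ∈ grade V (W := W) k, ZhuBimodule.mk V W w ∈ S k := by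
  induction k using Nat.strong_induction_on with
  | _ k ih =>
    rcases eq_or_ne k 0 with rfl | hk
    · exact h0
    suffices Submodule.span ℂ (creationSet V W k) ≤ (S k).comap (ZhuBimodule.mk V W) from
      fun w hw => this (h.grade_le_span hk hw)
    refine Submodule.span_le.2 ?_
    rintro _ ⟨d, p, n, hd, hn, hkd, a, ha, x, hx, rfl⟩
    have hlow : ∀ i < k, ∀ w ∈ grade V (W := W) i, ZhuBimodule.mk V W w ∈ S k :=
      fun i hi w hw => hmono hi.le (ih i hi w hw)
    -- A simple pole gives one of the two actions; a pole of order $m + 2$ gives an element of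
    -- $O(W)$.
    obtain rfl | ⟨m, rfl⟩ : n = 1 ∨ ∃ m, n = m + 2 := by
      rcases n with _ | _ | m
      · omega
      · exact Or.inl rfl
      · exact Or.inr ⟨m, rfl⟩
    · refine map_mode_mem_of_map_res_mem _ hkd hlow ha hx (K d) ?_
      obtain rfl : k = d + p := by omega
      -- The induction hypothesis is available for $x$ because $d \ge 1$ makes $p < d + p$.
      exact hstep d p hd a ha x (ih p (by omega) x hx)
    · refine map_mode_mem_of_map_res_mem _ hkd hlow ha hx d ?_
      have h1 : res d (-((m + 2 : ℕ) : ℤ)) a x - 0 ∈ zhuO V W := by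
        rw [sub_zero]
        exact res_mem_zhuO (j := 0) (m := m) ha x rfl (by push_cast; ring) (Nat.zero_le m)
      rw [ZhuBimodule.mk_eq h1, map_zero]
      exact zero_mem _

theorem modFiltration_le {S : ℕ → Submodule ℂ (ZhuBimodule V W)} (hmono : Monotone S)
    (h : ∀ k, ∀ w ∈ grade V (W := W) k, ZhuBimodule.mk V W w ∈ S k) (k : ℕ) :
    modFiltration V W k ≤ S k :=
  Submodule.map_le_iff_le_comap.2 (iSup₂_le fun i hi w hw => hmono hi (h i w hw))

theorem StronglyGeneratedBy.modFiltration_le_left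
    (h : StronglyGeneratedBy V (grade V (W := W) 0 : Set W)) (k : ℕ) :
    modFiltration V W k ≤
      Submodule.map₂ (zhuLeft V W) (algFiltration V k) (modFiltration V W 0) := by
  have hmono : Monotone fun k =>
      Submodule.map₂ (zhuLeft V W) (algFiltration V k) (modFiltration V W 0) :=
    fun k l hkl => Submodule.map₂_le_map₂_left (algFiltration_mono hkl)
  -- The exponent function is `id` because the kernel of the left action is
  -- $(1+z)^{\mathrm{wt}\,a}/z$.
  refine modFiltration_le hmono (h.mk_mem hmono (fun w hw => ?_) id
    fun d p _ a ha x hx => ?_) k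
  · rw [← zhuLeft_one (ZhuBimodule.mk V W w), modFiltration_zero]
    exact Submodule.apply_mem_map₂ _ (one_mem_algFiltration 0) (Submodule.mem_map_of_mem hw)
  · rw [id, ← leftMul_of_mem ha, ← zhuLeft_mk]
    -- By $a * (b * y) = (a * b) * y$, left multiplication by $a$ carries $A(V)_p * A(W)_0$ into
    -- $A(V)_{d+p} * A(W)_0$.
    refine (Submodule.map₂_le.2 fun b hb y hy => ?_ :
      Submodule.map₂ (zhuLeft V W) (algFiltration V p) (modFiltration V W 0) ≤
        (Submodule.map₂ (zhuLeft V W) (algFiltration V (d + p)) (modFiltration V W 0)).comap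
          (zhuLeft V W (ZhuAlgebra.mk V a))) hx
    rw [Submodule.mem_comap, ← zhuLeft_mul]
    exact Submodule.apply_mem_map₂ _ (mul_mem_algFiltration (mk_mem_algFiltration ha) hb) hy

theorem StronglyGeneratedBy.modFiltration_le_right
    (h : StronglyGeneratedBy V (grade V (W := W) 0 : Set W)) (k : ℕ) :
    modFiltration V W k ≤
      Submodule.map₂ (zhuRight V W) (algFiltration V k) (modFiltration V W 0) := by
  have hmono : Monotone fun k =>
      Submodule.map₂ (zhuRight V W) (algFiltration V k) (modFiltration V W 0) :=
    fun k l hkl => Submodule.map₂_le_map₂_left (algFiltration_mono hkl)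
  -- The right action has exponent $\mathrm{wt}\,a - 1$. The truncated subtraction is harmless
  -- because only $d \ge 1$ occurs.
  refine modFiltration_le hmono (h.mk_mem hmono (fun w hw => ?_) (· - 1)
    fun d p hd a ha x hx => ?_) k
  · rw [← zhuRight_one (ZhuBimodule.mk V W w), modFiltration_zero]
    exact Submodule.apply_mem_map₂ _ (one_mem_algFiltration 0) (Submodule.mem_map_of_mem hw)
  · obtain ⟨d, rfl⟩ := Nat.exists_eq_add_of_le' hd
    rw [Nat.add_sub_cancel, ← rightMul_of_mem_succ ha, ← zhuRight_mk]
    refine (Submodule.map₂_le.2 fun b hb y hy => ?_ :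
      Submodule.map₂ (zhuRight V W) (algFiltration V p) (modFiltration V W 0) ≤
        (Submodule.map₂ (zhuRight V W) (algFiltration V (d + 1 + p)) (modFiltration V W 0)).comap
          (zhuRight V W (ZhuAlgebra.mk V a))) hx
    -- Here $(y * b) * a = y * (b * a)$, so the new factor enters on the right of $b$ and the
    -- degrees add in the opposite order.
    rw [Submodule.mem_comap, ← zhuRight_mul, add_comm]
    exact Submodule.apply_mem_map₂ _ (mul_mem_algFiltration hb (mk_mem_algFiltration ha)) hy

/-! ### Balanced tensor products -/

variable (V) in
/-- The bilinear map `(x, y) ↦ x ⊗ y`. -/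
noncomputable def tmulBilin (M N : Type*) [AddCommGroup M] [Module ℂ M] [AdmissibleModule V M]
    [AddCommGroup N] [Module ℂ N] [AdmissibleModule V N] :
    ZhuBimodule V M →ₗ[ℂ] ZhuBimodule V N →ₗ[ℂ]
      BalancedTensor (ZhuAlgebra V) (ZhuBimodule V M) (ZhuBimodule V N) :=
  LinearMap.mk₂ ℂ (BalancedTensor.tmul (ZhuAlgebra V)) BalancedTensor.add_tmul
    BalancedTensor.smul_tmul BalancedTensor.tmul_add BalancedTensor.tmul_smul

theorem modFiltration_zero_eq_span {ι : Type*} {u : ι → W}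
    (hu : grade V (W := W) 0 = Submodule.span ℂ (Set.range u)) :
    modFiltration V W 0 = Submodule.span ℂ (Set.range fun i => ZhuBimodule.mk V W (u i)) := by
  rw [modFiltration_zero, hu, Submodule.map_span, ← Set.range_comp]
  rfl

theorem mk_mem_modFiltration_zero {ι : Type*} {u : ι → W}
    (hu : grade V (W := W) 0 = Submodule.span ℂ (Set.range u)) (i : ι) :
    ZhuBimodule.mk V W (u i) ∈ modFiltration V W 0 := by
  rw [modFiltration_zero_eq_span hu]
  exact Submodule.subset_span ⟨i, rfl⟩

end VOA

/-! ### The two inclusions for the tensor filtration -/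

theorem corollary4p12 {V M N : Type*} [AddCommGroup V] [Module ℂ V] [VOA.CFTTypeVOA V]
    [AddCommGroup M] [Module ℂ M] [VOA.AdmissibleModule V M]
    [AddCommGroup N] [Module ℂ N] [VOA.AdmissibleModule V N]
    {m n : ℕ} (u : Fin m → M) (v : Fin n → N)
    (hu : VOA.AdmissibleModule.grade V (W := M) 0 = Submodule.span ℂ (Set.range u))
    (hv : VOA.AdmissibleModule.grade V (W := N) 0 = Submodule.span ℂ (Set.range v))
    (hM : VOA.StronglyGeneratedBy V (VOA.AdmissibleModule.grade V (W := M) 0 : Set M))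
    (hN : VOA.StronglyGeneratedBy V (VOA.AdmissibleModule.grade V (W := N) 0 : Set N)) (r : ℕ) :
    VOA.tensorFiltration V M N r =
      ⨆ (i : Fin m) (j : Fin n), VOA.subspaceSMul (VOA.envFiltration V r)
        (VOA.BalancedTensor.tmul (VOA.ZhuAlgebra V)
          (VOA.ZhuBimodule.mk V M (u i)) (VOA.ZhuBimodule.mk V N (v j))) := by
  refine le_antisymm (Submodule.span_le.2 ?_) (iSup₂_le fun i j => ?_)
  · rintro _ ⟨k, l, hkl, x, hx, y, hy, rfl⟩
    -- Generating $A(M)$ from the left and $A(N)$ from the right leaves the bottom vectors next to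
    -- the tensor sign and the coefficients outside, where $A(V) \otimes A(V)^{op}$ acts.
    have hx := hM.modFiltration_le_left k hx
    have hy := hN.modFiltration_le_right l hy
    rw [VOA.modFiltration_zero_eq_span hu] at hx
    rw [VOA.modFiltration_zero_eq_span hv] at hy
    -- Writing each filtration step as the span of itself turns the image into the span of the
    -- products $a * u_i$, and likewise of the $v_j * b$ below, so that bilinearity leaves only pure
    -- tensors of such products.
    rw [← Submodule.span_eq (VOA.algFiltration V k), Submodule.map₂_span_span] at hx
    rw [← Submodule.span_eq (VOA.algFiltration V l), Submodule.map₂_span_span] at hy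
    have hxy := Submodule.apply_mem_map₂ (VOA.tmulBilin V M N) hx hy
    rw [Submodule.map₂_span_span] at hxy
    refine Submodule.span_le.2 ?_ hxy
    rintro _ ⟨_, ⟨a, ha, _, ⟨i, rfl⟩, rfl⟩, _, ⟨b, hb, _, ⟨j, rfl⟩, rfl⟩, rfl⟩
    refine Submodule.mem_iSup_of_mem i (Submodule.mem_iSup_of_mem j ?_)
    exact ⟨TensorProduct.tmul ℂ a (MulOpposite.op b),
      Submodule.subset_span ⟨k, l, hkl, a, ha, b, hb, rfl⟩, rfl⟩
  · refine Submodule.map_le_iff_le_comap.2 (Submodule.span_le.2 ?_)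
    rintro _ ⟨k, l, hkl, a, ha, b, hb, rfl⟩
    rw [SetLike.mem_coe, Submodule.mem_comap, LinearMap.restrictScalars_apply,
      LinearMap.toSpanSingleton_apply, VOA.balancedTensorModule_tmul_smul]
    have hx := VOA.zhuLeft_mem_modFiltration ha (VOA.mk_mem_modFiltration_zero hu i)
    have hy := VOA.zhuRight_mem_modFiltration hb (VOA.mk_mem_modFiltration_zero hv j)
    -- The vectors $u_i$ and $v_j$ have filtration degree 0, so $a * u_i$ and $v_j * b$ stay in
    -- degrees $k$ and $l$, with $k + l \le r$.
    rw [add_zero] at hx hy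
    exact Submodule.subset_span ⟨k, l, hkl, a • VOA.ZhuBimodule.mk V M (u i), hx,
      MulOpposite.op b • VOA.ZhuBimodule.mk V N (v j), hy, rfl⟩
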